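/- Let $G$ be a finite graph (multiple edges and self-loops allowed) with edge set $E(G)$. Put $N_G=\#E(G)$, $n_G=\#V(G)-1$, $h_G=N_G-n_G$, and let $$\Psi_G=\sum_T\prod_{e\notin T}\alpha_e,\qquad \Phi_G=\sum_T\prod_{e\in T}\alpha_e\qquad\text{in }\mathbb Z[\alpha_e : e\in E(G)],$$ where $T$ runs over the (edge sets of) spanning trees of $G$. For disjoint $I,J\subseteq E(G)$ let $\Phi^J_I\in\mathbb Z[\alpha_e : e\notin I\cup J]$ be the coefficient of $\prod_{j\in J}\alpha_j$ in $\Phi_G$, restricted to $\alpha_i=0$ for all $i\in I$, that is, $$\Phi^J_I=\sum_{T\supseteq J,\ T\cap I=\emptyset}\ \prod_{e\in T\setminus J}\alpha_e .$$ (If $G\setminus I$ is connected and $J$ contains no cycle, this is the dual graph polynomial of the graph obtained from $G$ by deleting $I$ and contracting $J$; otherwise it is $0$.) Let $q$ be a prime power and, for an integer polynomial $P$ in $m$ specified variables, let $[P]_q$ be the number of zeros of $P$ in $\mathbb F_q^m$. Call $G$ *duality admissible* (for $q$) if $G$ is log-divergent, i.e. $N_G=2h_G$, if $h_G,n_G\ge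 3$, and if $$[\Phi^J_I]_q\equiv 0 \pmod{q^3}$$ for all disjoint $I,J\subseteq E(G)$ with $|I|<|J|\le n_G$ and $|I|\le n_G-3$. **Theorem.** Let $q$ be a prime power and let $G$ be a duality admissible graph for $q$. Then $q^2$ divides both $[\Psi_G]_q$ and $[\Phi_G]_q$, so that the invariants $c_2(G)_q:=[\Psi_G]_q/q^2 \bmod q$ and $c_2^{dual}(G)_q:=[\Phi_G]_q/q^2\bmod q$ in $\mathbb Z/q\mathbb Z$ are defined, and $$c_2(G)_q=c_2^{dual}(G)_q .$$ Equivalently, $[\Psi_G]_q\equiv[\Phi_G]_q \pmod{q^3}$. In particular, if $G$ is duality admissible for every prime power $q$, the two $c_2$ invariants agree for every $q$. -/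

import Mathlib

open scoped Graph

/-!
Graphs are finite multigraphs: parallel edges and self-loops are allowed.  We use Mathlib's
`Graph V E`, whose vertex and edge sets are `V(G)` and `E(G)`.  The Schwinger parameters `α_e` are
the variables of `MvPolynomial E(G) ℤ`, one for each edge of `G`.
-/

namespace FeynmanGraph

/-- The number of `F`-rational points of the affine hypersurface `P = 0` in `𝔸^σ`, for a
polynomial `P` with integer coefficients in the variables `σ`. -/
noncomputable def pointCount {σ : Type*} (P : MvPolynomial σ ℤ) (F : Type*) [Field F] : ℕ :=
  Nat.card {a : σ → F // MvPolynomial.aeval a P = 0}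

/-- `N_G`, the number of edges. -/
def numEdges {V E : Type*} (G : Graph V E) [Fintype E(G)] : ℤ :=
  Fintype.card E(G)

/-- `n_G`, the number of vertices minus one. -/
def numVerticesPred {V E : Type*} (G : Graph V E) [Fintype V(G)] : ℤ :=
  Fintype.card V(G) - 1

/-- `h_G = N_G - n_G`, the loop number. -/
def loopNumber {V E : Type*} (G : Graph V E) [Fintype V(G)] [Fintype E(G)] : ℤ :=
  numEdges G - numVerticesPred G

/-- `G` is log-divergent if `N_G = 2 h_G`. -/
def LogDivergent {V E : Type*} (G : Graph V E) [Fintype V(G)] [Fintype E(G)] : Prop :=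
  numEdges G = 2 * loopNumber G

/-- A set `T` of edges is (the edge set of) a spanning tree of `G` if any two vertices of `G` are
joined by a path with edges in `T`, and `T` has exactly one edge less than `G` has vertices. -/
def IsSpanningTree {V E : Type*} (G : Graph V E) [Fintype V(G)] (T : Finset E(G)) : Prop :=
  (∀ u ∈ V(G), ∀ v ∈ V(G),
    Relation.ReflTransGen (fun x y => ∃ e ∈ T, G.IsLink (e : E) x y) u v) ∧
  T.card + 1 = Fintype.card V(G)

open scoped Classical in
/-- The collection of all spanning trees of `G` (empty if `G` is disconnected). -/
noncomputable def spanningTrees {V E : Type*} (G : Graph V E) [Fintype V(G)] [Fintype E(G)] :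
    Finset (Finset E(G)) :=
  Finset.univ.filter (fun T => IsSpanningTree G T)

open scoped Classical in
/-- The graph polynomial (first Symanzik polynomial) `Ψ_G = ∑_T ∏_{e ∉ T} α_e`. -/
noncomputable def graphPoly {V E : Type*} (G : Graph V E) [Fintype V(G)] [Fintype E(G)] :
    MvPolynomial E(G) ℤ :=
  ∑ T ∈ spanningTrees G, ∏ e ∈ Finset.univ.filter (fun e => e ∉ T), MvPolynomial.X e

/-- The dual graph polynomial `Φ_G = ∑_T ∏_{e ∈ T} α_e`. -/
noncomputable def dualGraphPoly {V E : Type*} (G : Graph V E) [Fintype V(G)] [Fintype E(G)] :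
    MvPolynomial E(G) ℤ :=
  ∑ T ∈ spanningTrees G, ∏ e ∈ T, MvPolynomial.X e

open scoped Classical in
/-- For disjoint `I` and `J`, the polynomial `Φ_I^J` in the variables `α_e`, `e ∉ I ∪ J`: the
coefficient of `∏_{j ∈ J} α_j` in `Φ_G`, restricted to `α_i = 0` for `i ∈ I`.  It is the dual graph
polynomial of the graph obtained from `G` by deleting `I` and contracting `J` (and it is `0` if `J`
contains a cycle or if deleting `I` disconnects `G`).  See `dualGraphPoly_eq_sum_dualMinorPoly`. -/
noncomputable def dualMinorPoly {V E : Type*} (G : Graph V E) [Fintype V(G)] [Fintype E(G)]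
    (I J : Finset E(G)) : MvPolynomial {e : E(G) // e ∉ I ∪ J} ℤ :=
  ∑ T ∈ (spanningTrees G).filter (fun T => J ⊆ T ∧ Disjoint I T),
    ∏ e ∈ Finset.univ.filter (fun e : {e : E(G) // e ∉ I ∪ J} => (e : E(G)) ∈ T),
      MvPolynomial.X e

open scoped Classical in
/-- The iterated contraction-deletion formula `Φ_G = ∑_{J ⊆ S} Φ^J_{S \ J} ∏_{j ∈ J} α_j`, which
characterizes the polynomials `Φ^J_I`. -/
theorem dualGraphPoly_eq_sum_dualMinorPoly {V E : Type*} (G : Graph V E) [Fintype V(G)]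
    [Fintype E(G)] (S : Finset E(G)) :
    dualGraphPoly G = ∑ J ∈ S.powerset,
      MvPolynomial.rename Subtype.val (dualMinorPoly G (S \ J) J) *
        ∏ j ∈ J, MvPolynomial.X j := by
  have key : ∀ J ∈ S.powerset,
      MvPolynomial.rename Subtype.val (dualMinorPoly G (S \ J) J) *
        ∏ j ∈ J, (MvPolynomial.X j : MvPolynomial E(G) ℤ) =
      ∑ T ∈ spanningTrees G, if T ∩ S = J then ∏ e ∈ T, MvPolynomial.X e else 0 := by
    intro J hJ
    rw [Finset.mem_powerset] at hJ
    rw [dualMinorPoly, map_sum, Finset.sum_mul, Finset.sum_filter]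
    refine Finset.sum_congr rfl fun T _ => ?_
    have hiff : (J ⊆ T ∧ Disjoint (S \ J) T) ↔ T ∩ S = J := by
      rw [Finset.disjoint_left]
      constructor
      · rintro ⟨h1, h2⟩
        ext e
        have := @h1 e
        have := @hJ e
        have := @h2 e
        simp only [Finset.mem_inter, Finset.mem_sdiff] at *
        tauto
      · rintro rfl
        refine ⟨Finset.inter_subset_left, fun e he => ?_⟩
        simp only [Finset.mem_inter, Finset.mem_sdiff] at *
        tauto
    by_cases h : T ∩ S = J
    · rw [if_pos (hiff.2 h), if_pos h, map_prod]
      simp only [MvPolynomial.rename_X]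
      have hu : S \ J ∪ J = S := Finset.sdiff_union_of_subset hJ
      have h3 : ∏ e ∈ Finset.univ.filter
            (fun e : {e : E(G) // e ∉ S \ J ∪ J} => (e : E(G)) ∈ T),
            (MvPolynomial.X (e : E(G)) : MvPolynomial E(G) ℤ) =
          ∏ e ∈ T \ S, MvPolynomial.X e := by
        refine Finset.prod_bij (fun e _ => (e : E(G))) ?_ ?_ ?_ ?_
        · intro e he
          have : (e : E(G)) ∉ S := fun h' => e.2 ((Finset.ext_iff.1 hu _).2 h')
          simp only [Finset.mem_filter, Finset.mem_univ, true_and] at he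
          exact Finset.mem_sdiff.2 ⟨he, this⟩
        · intro a _ b _ hab
          exact Subtype.ext hab
        · intro b hb
          rw [Finset.mem_sdiff] at hb
          exact ⟨⟨b, by rw [hu]; exact hb.2⟩, by simpa using hb.1, rfl⟩
        · intro _ _
          rfl
      rw [h3, ← h, ← Finset.prod_sdiff (Finset.inter_subset_left : T ∩ S ⊆ T)]
      rw [Finset.sdiff_inter_self_left]
    · rw [if_neg (fun h' => h (hiff.1 h')), if_neg h]
  rw [Finset.sum_congr rfl key, Finset.sum_comm, dualGraphPoly]
  refine Finset.sum_congr rfl fun T _ => ?_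
  rw [Finset.sum_ite_eq, if_pos (Finset.mem_powerset.2 Finset.inter_subset_right)]

/-- `G` is duality admissible over the finite field `F` with `q` elements: `G` is log-divergent,
`h_G, n_G ≥ 3`, and `[Φ_I^J] ≡ 0 mod q ^ 3` for all disjoint sets of edges `I`, `J` with
`|I| < |J|` and `|I| ≤ n_G - 3`, where `[·]` counts `F`-points in the affine space with coordinates
`α_e`, `e ∉ I ∪ J`.  For `|J| > n_G` the polynomial `Φ_I^J` vanishes identically for degree reasons,
and nothing is required. -/
def DualityAdmissible {V E : Type*} (G : Graph V E) [Fintype V(G)] [Fintype E(G)]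
    (F : Type*) [Field F] [Fintype F] : Prop :=
  LogDivergent G ∧ 3 ≤ loopNumber G ∧ 3 ≤ numVerticesPred G ∧
  ∀ I J : Finset E(G), Disjoint I J → I.card < J.card →
    (I.card : ℤ) ≤ numVerticesPred G - 3 → (J.card : ℤ) ≤ numVerticesPred G →
      pointCount (dualMinorPoly G I J) F ≡ 0 [MOD Fintype.card F ^ 3]

/-- `c₂(G)_q = [Ψ_G]_q / q² mod q`, where `q` is the number of elements of `F`.  It is meaningful
when `q²` divides `[Ψ_G]_q`. -/
noncomputable def c2 {V E : Type*} (G : Graph V E) [Fintype V(G)] [Fintype E(G)]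
    (F : Type*) [Field F] [Fintype F] : ZMod (Fintype.card F) :=
  ((pointCount (graphPoly G) F / Fintype.card F ^ 2 : ℕ) : ZMod (Fintype.card F))

/-- `c₂^dual(G)_q = [Φ_G]_q / q² mod q`, where `q` is the number of elements of `F`.  It is
meaningful when `q²` divides `[Φ_G]_q`. -/
noncomputable def c2dual {V E : Type*} (G : Graph V E) [Fintype V(G)] [Fintype E(G)]
    (F : Type*) [Field F] [Fintype F] : ZMod (Fintype.card F) :=
  ((pointCount (dualGraphPoly G) F / Fintype.card F ^ 2 : ℕ) : ZMod (Fintype.card F))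

end FeynmanGraph

/-!
Let `q` be the number of elements of `F` and `n = n_G = h_G`, so that `G` has `2 n` edges and all
spanning trees and their complements have `n` elements.

The proof counts the zeros of the multihomogeneous form `∑_T ∏_{e ∈ T} x_e ∏_{e ∉ T} y_e` in a
product of projective lines, one for each edge.  The Cremona transformation, inversion of all
coordinates, exchanges this form with the one belonging to the complements of the spanning trees
(`projCount_image_compl`).  Sorting points by the set of their infinite coordinates
(`projCount_eq_sum`) writes the same number as `∑_J [Φ^J]` and as `∑_I [Ψ_{G \ I}]`.  The terms with
`J = ∅` and `I = ∅` are the two point counts to be compared, and the terms with more than `n` indices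
are the same powers of `q` in both sums.  The terms with `1 ≤ |J| ≤ n` are divisible by `q ^ 3` by
admissibility, and it remains to see that `q ^ 3` divides `[Ψ_{G \ I}]` for `1 ≤ |I| ≤ n`, and that
`q ^ 2` divides `[Ψ_G]`.

For a connected graph `H` with `M` edges and `l` independent cycles, `Ψ_H` is the discriminant of the
quadratic form `∑_e α_e x_e ^ 2` on the cycle space (`exists_det_gram_eq_mul_treeSum`, from the
Cauchy–Binet formula and unimodularity).  So the zeros of `Ψ_H` are the degenerate forms in a family
of `M` rank one forms in dimension `l`.  Splitting off two independent rank one forms, and evaluating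
the number of zeros in their two parameters by the identity of Desnanot and Jacobi
(`det_bordered`), gives divisibility by `q ^ 2` whenever `M ≥ 2 l` (`sq_dvd_degenCount`).  If
`M > 2 l`, as for `H = G \ I`, the average valency of `H` is less than four, and `H` has a vertex of
valency at most three.  The coordinates of its edges satisfy a linear relation on the cycle space.
For three edges this relation turns the corresponding parameters into the entries of an arbitrary
symmetric matrix of size two, whose contribution is a quadric with `q ^ 2` points unless all its
nonconstant coefficients vanish; the number of the exceptional parameters is divisible by `q`
(`cube_dvd_degenCount`).

Throughout, divisibility by `q` and not only by the characteristic comes from the Ax–Katz theorem for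
systems with `∑ deg < #variables` (`card_dvd_card_solutions`).  It is proved with Teichmüller
representatives in the Witt vectors: the multinomial coefficients which survive the summation over
all points have enough digits to be divisible by `q`, by Legendre's formula.
-/

namespace FeynmanGraph

/-! ### Digit sums and multinomial coefficients -/

/-- The reduction of `m` modulo `q - 1` with representatives `1, …, q - 1` for positive `m`, and
`0` for `m = 0`.  For `q = 0` and `q = 1` the value is irrelevant. -/
def cyclicRes (q m : ℕ) : ℕ := if m = 0 then 0 else (m - 1) % (q - 1) + 1

theorem cyclicRes_modEq (q m : ℕ) : cyclicRes q m ≡ m [MOD (q - 1)] := by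
  unfold cyclicRes
  split_ifs with h
  · rw [h]
  · have := (Nat.mod_modEq (m - 1) (q - 1)).add_right 1
    rwa [Nat.sub_add_cancel (Nat.one_le_iff_ne_zero.2 h)] at this

theorem cyclicRes_eq_zero {q m : ℕ} (h : cyclicRes q m = 0) : m = 0 := by
  unfold cyclicRes at h
  split_ifs at h with h'
  exact h'

/-- `cyclicRes q m` is the least element of its class, among positive numbers if `m` is positive. -/
theorem cyclicRes_le {q m m' : ℕ} (h : m' ≡ m [MOD (q - 1)]) (h0 : m' = 0 → m = 0) :
    cyclicRes q m ≤ m' := by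
  unfold cyclicRes
  split_ifs with hm
  · exact Nat.zero_le _
  · have hm' : m' ≠ 0 := fun h' => hm (h0 h')
    obtain ⟨a, rfl⟩ := Nat.exists_eq_succ_of_ne_zero hm
    obtain ⟨b, rfl⟩ := Nat.exists_eq_succ_of_ne_zero hm'
    have h2 : b ≡ a [MOD (q - 1)] := Nat.ModEq.add_right_cancel' 1 h
    simp only [Nat.succ_eq_add_one, Nat.add_sub_cancel]
    rw [← show b % (q - 1) = a % (q - 1) from h2]
    have := Nat.mod_le b (q - 1)
    omega

theorem cyclicRes_congr {q m m' : ℕ} (h : m' ≡ m [MOD (q - 1)]) (h0 : m' = 0 ↔ m = 0) :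
    cyclicRes q m' = cyclicRes q m := by
  apply le_antisymm
  · exact cyclicRes_le ((cyclicRes_modEq q m).trans h.symm) fun h' => h0.2 (cyclicRes_eq_zero h')
  · exact cyclicRes_le ((cyclicRes_modEq q m').trans h) fun h' => h0.1 (cyclicRes_eq_zero h')

theorem cyclicRes_sum_mul_le {ι : Type*} (q : ℕ) (s : Finset ι) (c m : ι → ℕ) :
    cyclicRes q (∑ i ∈ s, c i * m i) ≤ ∑ i ∈ s, c i * cyclicRes q (m i) := by
  apply cyclicRes_le
  · exact Nat.ModEq.sum fun i _ => (cyclicRes_modEq q (m i)).mul_left _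
  · intro h
    rw [Finset.sum_eq_zero_iff] at h ⊢
    intro i hi
    rcases mul_eq_zero.1 (h i hi) with h | h
    · rw [h, zero_mul]
    · rw [cyclicRes_eq_zero h, mul_zero]

theorem le_cyclicRes_of_dvd {q m : ℕ} (hm : 0 < m) (h : (q - 1) ∣ m) :
    q - 1 ≤ cyclicRes q m := by
  have h1 : (q - 1) ∣ cyclicRes q m := (Nat.modEq_zero_iff_dvd.1
    ((cyclicRes_modEq q m).trans (Nat.modEq_zero_iff_dvd.2 h)))
  exact Nat.le_of_dvd (Nat.pos_of_ne_zero fun h' => hm.ne' (cyclicRes_eq_zero h')) h1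

theorem digits_sum_eq {p : ℕ} (hp : 1 < p) (m : ℕ) :
    (p.digits m).sum = m % p + (p.digits (m / p)).sum := by
  rcases Nat.eq_zero_or_pos m with rfl | hm
  · simp
  · rw [Nat.digits_def' hp hm, List.sum_cons]

theorem digits_sum_mul_pow {p : ℕ} (hp : 1 < p) (m t : ℕ) :
    (p.digits (p ^ t * m)).sum = (p.digits m).sum := by
  induction t with
  | zero => simp
  | succ t ih =>
    rw [digits_sum_eq hp, pow_succ', mul_assoc, Nat.mul_mod_right, zero_add,
      Nat.mul_div_cancel_left _ (by omega), ih]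

theorem digits_sum_pow_sub_one {p : ℕ} (hp : 1 < p) (k : ℕ) :
    (p.digits (p ^ k - 1)).sum = k * (p - 1) := by
  induction k with
  | zero => simp
  | succ k ih =>
    have h : p ^ (k + 1) - 1 = (p - 1) + p * (p ^ k - 1) := by
      have := Nat.one_le_pow k p (by omega)
      have := Nat.le_mul_of_pos_right p this
      rw [pow_succ', Nat.mul_sub]
      omega
    have hlt : p - 1 < p := by omega
    rw [digits_sum_eq hp, h, Nat.add_mul_mod_self_left, Nat.mod_eq_of_lt hlt,
      Nat.add_mul_div_left _ _ (by omega), Nat.div_eq_of_lt hlt, zero_add, ih]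
    ring

/-- The cyclic residues of `m, p m, p² m, …` are bounded on average by the digit sum of `m`. -/
theorem sub_one_mul_sum_cyclicRes_le {p k : ℕ} (hp : 1 < p) (m : ℕ) :
    (p - 1) * ∑ t ∈ Finset.range k, cyclicRes (p ^ k) (p ^ t * m) ≤
      (p ^ k - 1) * (p.digits m).sum := by
  induction m using Nat.strong_induction_on with
  | _ m ih =>
  rcases Nat.eq_zero_or_pos m with rfl | hm
  · simp [cyclicRes]
  have hlt : m / p < m := Nat.div_lt_self hm hp
  have h1 : ∀ t, cyclicRes (p ^ k) (p ^ t * m) ≤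
      cyclicRes (p ^ k) (p ^ (t + 1) * (m / p)) + (m % p) * p ^ t := by
    intro t
    apply cyclicRes_le
    · have h : p ^ t * m = p ^ (t + 1) * (m / p) + (m % p) * p ^ t := by
        conv_lhs => rw [← Nat.div_add_mod m p]
        ring
      rw [h]
      exact (cyclicRes_modEq _ _).add_right _
    · intro h
      have h2 := Nat.eq_zero_of_add_eq_zero h
      have h3 := cyclicRes_eq_zero h2.1
      have hpt : p ^ t ≠ 0 := pow_ne_zero _ (by omega)
      have h4 : m % p = 0 := by
        rcases mul_eq_zero.1 h2.2 with h | h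
        · exact h
        · exact absurd h hpt
      have h5 : m / p = 0 := by
        rcases mul_eq_zero.1 h3 with h | h
        · exact absurd h (pow_ne_zero _ (by omega))
        · exact h
      have := Nat.div_add_mod m p
      rw [h4, h5] at this
      omega
  -- multiplication by `p` permutes the exponents cyclically, because `p ^ k ≡ 1` mod `p ^ k - 1`
  have h2 : ∑ t ∈ Finset.range k, cyclicRes (p ^ k) (p ^ (t + 1) * (m / p)) =
      ∑ t ∈ Finset.range k, cyclicRes (p ^ k) (p ^ t * (m / p)) := by
    have h := Finset.sum_range_succ' (fun t => cyclicRes (p ^ k) (p ^ t * (m / p))) k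
    rw [Finset.sum_range_succ] at h
    have h' : cyclicRes (p ^ k) (p ^ k * (m / p)) = cyclicRes (p ^ k) (p ^ 0 * (m / p)) := by
      apply cyclicRes_congr
      · apply Nat.ModEq.mul_right
        have hk := Nat.one_le_pow k p (by omega)
        have := Nat.ModEq.add_right 1 (Nat.modEq_zero_iff_dvd.2 (dvd_refl (p ^ k - 1)))
        rw [Nat.sub_add_cancel hk, zero_add] at this
        simpa using this
      · simp
        omega
    rw [h'] at h
    exact (Nat.add_right_cancel h).symm
  have h3 : (p - 1) * ∑ t ∈ Finset.range k, p ^ t = p ^ k - 1 := by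
    rw [mul_comm]
    exact Nat.geomSum_eq hp k ▸ Nat.div_mul_cancel (by
      simpa using Nat.sub_dvd_pow_sub_pow p 1 k)
  calc (p - 1) * ∑ t ∈ Finset.range k, cyclicRes (p ^ k) (p ^ t * m)
      ≤ (p - 1) * ∑ t ∈ Finset.range k,
          (cyclicRes (p ^ k) (p ^ (t + 1) * (m / p)) + (m % p) * p ^ t) :=
        Nat.mul_le_mul_left _ (Finset.sum_le_sum fun t _ => h1 t)
    _ = (p - 1) * ∑ t ∈ Finset.range k, cyclicRes (p ^ k) (p ^ t * (m / p)) +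
          (m % p) * ((p - 1) * ∑ t ∈ Finset.range k, p ^ t) := by
        rw [Finset.sum_add_distrib, h2, ← Finset.mul_sum]
        ring
    _ ≤ (p ^ k - 1) * (p.digits (m / p)).sum + (m % p) * (p ^ k - 1) := by
        rw [h3]
        exact Nat.add_le_add_right (ih _ hlt) _
    _ = (p ^ k - 1) * (p.digits m).sum := by
        rw [digits_sum_eq hp m]
        ring

/-- Legendre's formula for multinomial coefficients. -/
theorem sub_one_mul_padicValNat_multinomial {ι : Type*} (p : ℕ) [hp : Fact p.Prime] (s : Finset ι)
    (m : ι → ℕ) :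
    (p - 1) * padicValNat p (Nat.multinomial s m) + (p.digits (∑ i ∈ s, m i)).sum =
      ∑ i ∈ s, (p.digits (m i)).sum := by
  have hfac : ∀ n : ℕ, (p - 1) * padicValNat p n.factorial + (p.digits n).sum = n := fun n => by
    rw [sub_one_mul_padicValNat_factorial]
    exact Nat.sub_add_cancel (Nat.digit_sum_le p n)
  have h1 := congrArg (padicValNat p) (Nat.multinomial_spec s m)
  have h0 : ∏ i ∈ s, (m i).factorial ≠ 0 :=
    Finset.prod_ne_zero_iff.2 fun i _ => Nat.factorial_ne_zero _
  rw [padicValNat.mul h0 (Nat.multinomial_pos s m).ne'] at h1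
  have h2 : padicValNat p (∏ i ∈ s, (m i).factorial) = ∑ i ∈ s, padicValNat p (m i).factorial := by
    have h := Nat.factorization_prod (S := s) (g := fun i => (m i).factorial)
      fun i _ => Nat.factorial_ne_zero (m i)
    have h' := DFunLike.congr_fun h p
    simpa [Nat.factorization_def _ hp.out] using h'
  have h3 : (p - 1) * ∑ i ∈ s, padicValNat p (m i).factorial + ∑ i ∈ s, (p.digits (m i)).sum =
      ∑ i ∈ s, m i := by
    rw [Finset.mul_sum, ← Finset.sum_add_distrib]
    exact Finset.sum_congr rfl fun i _ => hfac (m i)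
  have h4 := hfac (∑ i ∈ s, m i)
  rw [← h1, h2, mul_add] at h4
  omega

/-- The arithmetic core of the Ax–Katz theorem: if the exponent of every variable is a positive
multiple of `q - 1` and the degrees are small, then the multinomial coefficients in the expansion of
`∏_j P_j ^ (p ^ (k - 1) * (q - 1))` are jointly divisible by `q = p ^ k`. -/
theorem pow_dvd_prod_multinomial {σ J α : Type*} [Fintype σ] [Fintype J] (p k : ℕ)
    [hp : Fact p.Prime] (hk : 0 < k) (s : J → Finset α) (a : α → σ → ℕ) (d : J → ℕ)
    (hd : ∀ j, ∀ x ∈ s j, ∑ i, a x i ≤ d j) (hlt : ∑ j, d j < Fintype.card σ) (m : J → α → ℕ)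
    (hm : ∀ j, ∑ x ∈ s j, m j x = p ^ (k - 1) * (p ^ k - 1))
    (hpos : ∀ i, 0 < ∑ j, ∑ x ∈ s j, a x i * m j x)
    (hdvd : ∀ i, (p ^ k - 1) ∣ ∑ j, ∑ x ∈ s j, a x i * m j x) :
    p ^ k ∣ ∏ j, Nat.multinomial (s j) (m j) := by
  have hp1 : 1 < p := hp.out.one_lt
  have hq : 1 < p ^ k := Nat.one_lt_pow hk.ne' hp1
  set Q := p ^ k - 1 with hQ
  have hQ0 : 0 < Q := by omega
  -- `R t j` is the weight of the `j`-th factor after the shift by `p ^ t`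
  set R : ℕ → J → ℕ := fun t j => ∑ x ∈ s j, cyclicRes (p ^ k) (p ^ t * m j x) with hR
  have hRdvd : ∀ t j, Q ∣ R t j := by
    intro t j
    apply Nat.modEq_zero_iff_dvd.1
    have h1 : R t j ≡ ∑ x ∈ s j, p ^ t * m j x [MOD Q] :=
      Nat.ModEq.sum fun x _ => cyclicRes_modEq _ _
    refine h1.trans ?_
    rw [← Finset.mul_sum, hm]
    exact Nat.modEq_zero_iff_dvd.2 (Dvd.intro_left (p ^ t * p ^ (k - 1)) (by ring))
  have hRpos : ∀ t j, 0 < R t j := by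
    intro t j
    rw [Nat.pos_iff_ne_zero]
    intro h
    rw [hR, Finset.sum_eq_zero_iff] at h
    have h1 : ∑ x ∈ s j, m j x = 0 := by
      refine Finset.sum_eq_zero fun x hx => ?_
      rcases mul_eq_zero.1 (cyclicRes_eq_zero (h x hx)) with h | h
      · exact absurd h (pow_ne_zero _ (by omega))
      · exact h
    rw [hm] at h1
    rcases mul_eq_zero.1 h1 with h | h
    · exact pow_ne_zero _ (by omega) h
    · omega
  choose r hr using hRdvd
  have hr1 : ∀ t j, 1 ≤ r t j := by
    intro t j
    have := hRpos t j
    rw [hr] at this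
    exact Nat.pos_of_mul_pos_left this
  -- all `u_i` are positive multiples of `q - 1`, and stay so after the shift
  have hbound : ∀ t, Fintype.card σ ≤ ∑ j, d j * r t j := by
    intro t
    have h1 : ∀ i, Q ≤ ∑ j, ∑ x ∈ s j, a x i * cyclicRes (p ^ k) (p ^ t * m j x) := by
      intro i
      have h2 : p ^ t * ∑ j, ∑ x ∈ s j, a x i * m j x =
          ∑ y ∈ Finset.univ.sigma s, a y.2 i * (p ^ t * m y.1 y.2) := by
        rw [Finset.sum_sigma, Finset.mul_sum]
        refine Finset.sum_congr rfl fun j _ => ?_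
        rw [Finset.mul_sum]
        exact Finset.sum_congr rfl fun x _ => by ring
      have h3 : Q ≤ cyclicRes (p ^ k) (p ^ t * ∑ j, ∑ x ∈ s j, a x i * m j x) :=
        le_cyclicRes_of_dvd (Nat.mul_pos (by positivity) (hpos i)) ((hdvd i).mul_left _)
      rw [h2] at h3
      refine h3.trans ((cyclicRes_sum_mul_le _ _ _ _).trans (le_of_eq ?_))
      rw [Finset.sum_sigma]
    have h2 : Fintype.card σ * Q ≤ ∑ j, d j * R t j := by
      calc Fintype.card σ * Q = ∑ _i : σ, Q := by simp
        _ ≤ ∑ i, ∑ j, ∑ x ∈ s j, a x i * cyclicRes (p ^ k) (p ^ t * m j x) :=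
          Finset.sum_le_sum fun i _ => h1 i
        _ = ∑ j, ∑ x ∈ s j, (∑ i, a x i) * cyclicRes (p ^ k) (p ^ t * m j x) := by
          rw [Finset.sum_comm]
          refine Finset.sum_congr rfl fun j _ => ?_
          rw [Finset.sum_comm]
          exact Finset.sum_congr rfl fun x _ => by rw [Finset.sum_mul]
        _ ≤ ∑ j, ∑ x ∈ s j, d j * cyclicRes (p ^ k) (p ^ t * m j x) :=
          Finset.sum_le_sum fun j _ => Finset.sum_le_sum fun x hx =>
            Nat.mul_le_mul_right _ (hd j x hx)
        _ = ∑ j, d j * R t j := Finset.sum_congr rfl fun j _ => by rw [hR, Finset.mul_sum]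
    refine Nat.le_of_mul_le_mul_right (h2.trans (le_of_eq ?_)) hQ0
    rw [Finset.sum_mul]
    exact Finset.sum_congr rfl fun j _ => by rw [hr]; ring
  -- since the degrees are small, some `r t j` exceeds `1`, for each of the `k` shifts
  have hsum : ∀ t, Fintype.card J + 1 ≤ ∑ j, r t j := by
    intro t
    by_contra hcon
    have h1 : ∑ j, r t j ≤ ∑ _j : J, 1 := by
      simp
      omega
    have h2 : ∀ j ∈ Finset.univ, 1 = r t j :=
      (Finset.sum_eq_sum_iff_of_le fun j _ => hr1 t j).1
        (le_antisymm (Finset.sum_le_sum fun j _ => hr1 t j) h1)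
    have h3 := hbound t
    have h4 : ∑ j, d j * r t j = ∑ j, d j :=
      Finset.sum_congr rfl fun j hj => by rw [← h2 j hj, mul_one]
    omega
  -- the digit sums of all exponents together
  set D := ∑ j, ∑ x ∈ s j, (p.digits (m j x)).sum with hD
  have h1 : (p - 1) * (k * (Fintype.card J + 1)) ≤ D := by
    have h2 : Q * ((p - 1) * (k * (Fintype.card J + 1))) ≤ Q * D := by
      calc Q * ((p - 1) * (k * (Fintype.card J + 1)))
          = (p - 1) * ∑ _t ∈ Finset.range k, Q * (Fintype.card J + 1) := by
            rw [Finset.sum_const, Finset.card_range, smul_eq_mul]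
            ring
        _ ≤ (p - 1) * ∑ t ∈ Finset.range k, ∑ j, R t j := by
            refine Nat.mul_le_mul_left _ (Finset.sum_le_sum fun t _ => ?_)
            rw [Finset.sum_congr rfl fun j _ => hr t j, ← Finset.mul_sum]
            exact Nat.mul_le_mul_left _ (hsum t)
        _ = ∑ j, ∑ x ∈ s j,
              (p - 1) * ∑ t ∈ Finset.range k, cyclicRes (p ^ k) (p ^ t * m j x) := by
            rw [Finset.sum_comm, Finset.mul_sum]
            refine Finset.sum_congr rfl fun j _ => ?_
            rw [hR, Finset.sum_comm, Finset.mul_sum]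
        _ ≤ ∑ j, ∑ x ∈ s j, Q * (p.digits (m j x)).sum :=
            Finset.sum_le_sum fun j _ => Finset.sum_le_sum fun x _ =>
              sub_one_mul_sum_cyclicRes_le hp1 _
        _ = Q * D := by
            rw [hD, Finset.mul_sum]
            exact Finset.sum_congr rfl fun j _ => by rw [Finset.mul_sum]
    exact Nat.le_of_mul_le_mul_left h2 hQ0
  have h2 : (p - 1) * ∑ j, padicValNat p (Nat.multinomial (s j) (m j)) +
      Fintype.card J * (k * (p - 1)) = D := by
    have h : ∑ _j : J, k * (p - 1) = Fintype.card J * (k * (p - 1)) := by simp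
    rw [← h, Finset.mul_sum, ← Finset.sum_add_distrib]
    refine Finset.sum_congr rfl fun j _ => ?_
    rw [← sub_one_mul_padicValNat_multinomial, hm, digits_sum_mul_pow hp1,
      digits_sum_pow_sub_one hp1]
  have h3 : k ≤ ∑ j, padicValNat p (Nat.multinomial (s j) (m j)) := by
    have h4 : (p - 1) * k ≤ (p - 1) * ∑ j, padicValNat p (Nat.multinomial (s j) (m j)) := by
      have : (p - 1) * (k * (Fintype.card J + 1)) =
        (p - 1) * k + Fintype.card J * (k * (p - 1)) := by ring
      omega
    exact Nat.le_of_mul_le_mul_left h4 (by omega)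
  refine (pow_dvd_pow p h3).trans ?_
  rw [← Finset.prod_pow_eq_pow_sum]
  exact Finset.prod_dvd_prod_of_dvd _ _ fun j _ => pow_padicValNat_dvd

/-! ### The Ax–Katz theorem -/

open WittVector in
theorem p_dvd_of_coeff_zero {p : ℕ} [Fact p.Prime] {F : Type*} [Field F] [CharP F p]
    [PerfectRing F p] {y : WittVector p F} (hy : y.coeff 0 = 0) : (p : WittVector p F) ∣ y := by
  by_cases h0 : y = 0
  · rw [h0]
    exact dvd_zero _
  obtain ⟨m, b, hb, h⟩ := exists_eq_pow_p_mul y h0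
  cases m with
  | zero =>
    rw [pow_zero, one_mul] at h
    rw [h] at hy
    exact absurd hy hb
  | succ m =>
    rw [h, pow_succ', mul_assoc]
    exact dvd_mul_right _ _

/-- A high power of a Witt vector is, modulo `p ^ k`, the indicator function of its being
invertible. -/
theorem pow_dvd_pow_sub_indicator {p : ℕ} [Fact p.Prime] {F : Type*} [Field F] [Fintype F]
    [CharP F p] [DecidableEq F] {k : ℕ} (hk : 0 < k) (hq : Fintype.card F = p ^ k)
    (y : WittVector p F) :
    (p : WittVector p F) ^ k ∣
      y ^ (p ^ (k - 1) * (p ^ k - 1)) - (if y.coeff 0 = 0 then 0 else 1) := by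
  have hp := (Fact.out : p.Prime).one_lt
  split_ifs with h
  · rw [sub_zero]
    refine (pow_dvd_pow_of_dvd (p_dvd_of_coeff_zero h) k).trans (pow_dvd_pow y ?_)
    have h1 : k - 1 < p ^ (k - 1) := Nat.lt_pow_self hp
    have h2 : 1 < p ^ k := Nat.one_lt_pow hk.ne' hp
    calc k ≤ p ^ (k - 1) := by omega
      _ ≤ p ^ (k - 1) * (p ^ k - 1) := Nat.le_mul_of_pos_right _ (by omega)
  · have h1 : (p : WittVector p F) ∣ y ^ (p ^ k - 1) - 1 := by
      apply p_dvd_of_coeff_zero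
      have h2 : (y ^ (p ^ k - 1) - 1).coeff 0 =
          WittVector.constantCoeff (y ^ (p ^ k - 1) - 1) := rfl
      rw [h2, map_sub, map_pow, map_one, ← hq]
      exact sub_eq_zero.2 (FiniteField.pow_card_sub_one_eq_one _ h)
    have h2 := dvd_sub_pow_of_dvd_sub h1 (k - 1)
    rwa [one_pow, ← pow_mul, Nat.sub_add_cancel hk, mul_comm (p ^ k - 1)] at h2

/-- Power sums of Teichmüller representatives vanish unless `q - 1` divides the exponent. -/
theorem sum_teichmuller_pow_eq_zero (p : ℕ) [Fact p.Prime] {F : Type*} [Field F] [Fintype F]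
    [CharP F p] {u : ℕ} (hu : ¬ (Fintype.card F - 1) ∣ u) :
    ∑ x : F, WittVector.teichmuller p x ^ u = 0 := by
  obtain ⟨g, hg⟩ := IsCyclic.exists_generator (α := Fˣ)
  have h1 : (g : F) ^ u ≠ 1 := by
    intro h
    apply hu
    have h2 : g ^ u = 1 := Units.ext (by simpa using h)
    have h3 := orderOf_dvd_of_pow_eq_one h2
    rwa [orderOf_eq_card_of_forall_mem_zpowers hg, Nat.card_units, Nat.card_eq_fintype_card] at h3
  set S := ∑ x : F, WittVector.teichmuller p x ^ u with hS
  have h2 : WittVector.teichmuller p (g : F) ^ u * S = S := by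
    rw [hS, Finset.mul_sum]
    refine Fintype.sum_equiv (Units.mulLeft g) _ _ fun x => ?_
    rw [Units.mulLeft_apply, map_mul, mul_pow]
  have h3 : (WittVector.teichmuller p (g : F) ^ u - 1) * S = 0 := by
    rw [sub_mul, h2, one_mul, sub_self]
  rcases mul_eq_zero.1 h3 with h | h
  · exfalso
    apply h1
    have h4 := congrArg WittVector.constantCoeff h
    rw [map_sub, map_pow, map_one, map_zero, sub_eq_zero] at h4
    rwa [WittVector.constantCoeff_apply, WittVector.teichmuller_coeff_zero] at h4
  · exact h

/-- The lift of a polynomial function to Witt vectors, along Teichmüller representatives. -/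
noncomputable def teichmullerEval (p : ℕ) [Fact p.Prime] {F σ : Type*} [Field F] [Fintype σ]
    (f : MvPolynomial σ F) (x : σ → F) : WittVector p F :=
  ∑ a ∈ f.support, WittVector.teichmuller p (f.coeff a) * ∏ i, WittVector.teichmuller p (x i) ^ a i

theorem teichmullerEval_coeff_zero (p : ℕ) [Fact p.Prime] {F σ : Type*} [Field F] [Fintype σ]
    (f : MvPolynomial σ F) (x : σ → F) :
    (teichmullerEval p f x).coeff 0 = MvPolynomial.eval x f := by
  have h : (teichmullerEval p f x).coeff 0 = WittVector.constantCoeff (teichmullerEval p f x) := rfl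
  rw [h, teichmullerEval, MvPolynomial.eval_eq', map_sum]
  refine Finset.sum_congr rfl fun a _ => ?_
  rw [map_mul, map_prod, WittVector.constantCoeff_apply, WittVector.teichmuller_coeff_zero]
  congr 1
  refine Finset.prod_congr rfl fun i _ => ?_
  rw [map_pow, WittVector.constantCoeff_apply, WittVector.teichmuller_coeff_zero]

/-- The power sums met in the expansion of the indicator function of a system of small degrees are
divisible by `q`: each monomial either misses a variable, or has a vanishing sum, or has a
coefficient divisible by `q`. -/
theorem pow_dvd_sum_prod_teichmullerEval_pow {p : ℕ} [Fact p.Prime] {F : Type*} [Field F]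
    [Fintype F] [CharP F p] {k : ℕ} (hk : 0 < k) (hq : Fintype.card F = p ^ k)
    {σ J : Type*} [Fintype σ] [DecidableEq σ] [Fintype J] (f : J → MvPolynomial σ F)
    (hf : ∑ j, (f j).totalDegree < Fintype.card σ) :
    (p : WittVector p F) ^ k ∣
      ∑ x : σ → F, ∏ j, teichmullerEval p (f j) x ^ (p ^ (k - 1) * (p ^ k - 1)) := by
  classical
  set K := p ^ (k - 1) * (p ^ k - 1) with hK
  let τ := WittVector.teichmuller p (R := F)
  set s : J → Finset (σ →₀ ℕ) := fun j => (f j).support with hs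
  have hexp : ∀ x : σ → F, ∏ j, teichmullerEval p (f j) x ^ K =
      ∑ m ∈ Fintype.piFinset fun j => Finset.piAntidiag (s j) K,
        (∏ j, (Nat.multinomial (s j) (m j) : WittVector p F)) *
          (∏ j, ∏ a ∈ s j, τ ((f j).coeff a) ^ m j a) *
            ∏ i, τ (x i) ^ (∑ j, ∑ a ∈ s j, a i * m j a) := by
    intro x
    simp only [teichmullerEval, Finset.sum_pow_eq_sum_piAntidiag]
    rw [Finset.prod_univ_sum]
    refine Finset.sum_congr rfl fun m _ => ?_
    rw [Finset.prod_mul_distrib, mul_assoc]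
    congr 1
    have h : ∏ i, τ (x i) ^ (∑ j, ∑ a ∈ s j, a i * m j a) =
        ∏ j, ∏ a ∈ s j, (∏ i, τ (x i) ^ a i) ^ m j a := by
      simp only [← Finset.prod_pow_eq_pow_sum, ← Finset.prod_pow, ← pow_mul]
      rw [Finset.prod_comm]
      exact Finset.prod_congr rfl fun j _ => Finset.prod_comm
    rw [h, ← Finset.prod_mul_distrib]
    refine Finset.prod_congr rfl fun j _ => ?_
    rw [← Finset.prod_mul_distrib]
    exact Finset.prod_congr rfl fun a _ => mul_pow _ _ _
  rw [Finset.sum_congr rfl fun x _ => hexp x, Finset.sum_comm]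
  refine Finset.dvd_sum fun m hm => ?_
  rw [← Finset.mul_sum]
  set u : σ → ℕ := fun i => ∑ j, ∑ a ∈ s j, a i * m j a with hu
  have hprod : ∑ x : σ → F, ∏ i, τ (x i) ^ u i = ∏ i, ∑ y : F, τ y ^ u i := by
    rw [Finset.prod_univ_sum, Fintype.piFinset_univ]
  rw [hprod]
  by_cases h1 : ∃ i, ¬ (Fintype.card F - 1) ∣ u i
  · obtain ⟨i, hi⟩ := h1
    rw [Finset.prod_eq_zero (Finset.mem_univ i) (sum_teichmuller_pow_eq_zero p hi), mul_zero]
    exact dvd_zero _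
  push Not at h1
  by_cases h2 : ∃ i, u i = 0
  · obtain ⟨i, hi⟩ := h2
    refine Dvd.dvd.mul_left ?_ _
    refine Dvd.dvd.trans ?_ (Finset.dvd_prod_of_mem _ (Finset.mem_univ i))
    rw [hi]
    simp [hq]
  push Not at h2
  refine Dvd.dvd.mul_right (Dvd.dvd.mul_right ?_ _) _
  rw [← Nat.cast_prod, ← Nat.cast_pow]
  apply Nat.cast_dvd_cast
  refine pow_dvd_prod_multinomial p k hk s (fun a => ⇑a) (fun j => (f j).totalDegree)
    ?_ hf m ?_ ?_ ?_
  · intro j a ha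
    have := MvPolynomial.le_totalDegree ha
    rwa [Finsupp.sum_fintype _ _ fun _ => rfl] at this
  · intro j
    have := Fintype.mem_piFinset.1 hm j
    rw [Finset.mem_piAntidiag] at this
    exact this.1
  · exact fun i => Nat.pos_of_ne_zero (h2 i)
  · rw [← hq]
    exact h1

theorem pow_dvd_of_witt {p : ℕ} [Fact p.Prime] {F : Type*} [Field F] [CharP F p] {k N : ℕ}
    (h : (p : WittVector p F) ^ k ∣ (N : WittVector p F)) : p ^ k ∣ N := by
  rcases Nat.eq_zero_or_pos N with rfl | hN
  · exact dvd_zero _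
  obtain ⟨e, N', hN', rfl⟩ := Nat.exists_eq_pow_mul_and_not_dvd hN.ne' p
    (Fact.out : p.Prime).ne_one
  by_cases hek : k ≤ e
  · exact (pow_dvd_pow p hek).mul_right _
  exfalso
  obtain ⟨t, rfl⟩ := Nat.exists_eq_add_of_lt (not_le.1 hek)
  have hp0 : (p : WittVector p F) ≠ 0 := WittVector.p_nonzero p F
  rw [Nat.cast_mul, Nat.cast_pow, add_assoc, pow_add] at h
  have h1 := (mul_dvd_mul_iff_left (pow_ne_zero e hp0)).1 h
  have h2 : (p : WittVector p F) ∣ (N' : WittVector p F) :=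
    (dvd_pow_self _ (Nat.succ_ne_zero t)).trans h1
  obtain ⟨c, hc⟩ := h2
  have h3 := congrArg WittVector.constantCoeff hc
  rw [map_natCast, map_mul, map_natCast, CharP.cast_eq_zero F p, zero_mul] at h3
  exact hN' ((CharP.cast_eq_zero_iff F p N').1 h3)

/-- The **Ax–Katz theorem** for systems whose degrees sum to less than the number of variables: the
number of solutions is divisible by the number `q` of elements of the field, and not only by its
characteristic. -/
theorem card_dvd_card_solutions {F : Type*} [Field F] [Fintype F] {σ J : Type*} [Fintype σ]
    [Fintype J] (f : J → MvPolynomial σ F) (hf : ∑ j, (f j).totalDegree < Fintype.card σ) :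
    Fintype.card F ∣ Nat.card {x : σ → F // ∀ j, MvPolynomial.eval x (f j) = 0} := by
  classical
  obtain ⟨p, hpc⟩ := CharP.exists F
  obtain ⟨k, hp, hq⟩ := FiniteField.card F p
  have : Fact p.Prime := ⟨hp⟩
  have hk : 0 < (k : ℕ) := k.2
  set K := p ^ ((k : ℕ) - 1) * (p ^ (k : ℕ) - 1) with hK
  rw [hq]
  apply pow_dvd_of_witt (F := F)
  set L : J → (σ → F) → WittVector p F := fun j x => teichmullerEval p (f j) x with hL
  have h1 : ((Nat.card {x : σ → F // ∀ j, MvPolynomial.eval x (f j) = 0} : ℕ) : WittVector p F) =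
      ∑ x : σ → F, ∏ j, (1 - (if (L j x).coeff 0 = 0 then 0 else 1 : WittVector p F)) := by
    rw [Nat.card_eq_fintype_card, Fintype.card_subtype, Finset.card_filter, Nat.cast_sum]
    refine Finset.sum_congr rfl fun x _ => ?_
    simp only [hL, teichmullerEval_coeff_zero]
    by_cases h : ∀ j, MvPolynomial.eval x (f j) = 0
    · simp [h]
    · rw [if_neg h]
      push Not at h
      obtain ⟨j, hj⟩ := h
      rw [Finset.prod_eq_zero (Finset.mem_univ j)]
      · simp
      · simp [hj]
  have h2 : (p : WittVector p F) ^ (k : ℕ) ∣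
      (∑ x : σ → F, ∏ j, (1 - (if (L j x).coeff 0 = 0 then 0 else 1 : WittVector p F))) -
        ∑ x : σ → F, ∏ j, (1 - L j x ^ K) := by
    rw [← Finset.sum_sub_distrib]
    refine Finset.dvd_sum fun x _ => ?_
    rw [← Ideal.mem_span_singleton, ← Ideal.Quotient.eq, map_prod, map_prod]
    refine Finset.prod_congr rfl fun j _ => ?_
    rw [Ideal.Quotient.eq, Ideal.mem_span_singleton]
    have := pow_dvd_pow_sub_indicator hk hq (L j x)
    rwa [sub_sub_sub_cancel_left]
  have h3 : (p : WittVector p F) ^ (k : ℕ) ∣ ∑ x : σ → F, ∏ j, (1 - L j x ^ K) := by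
    have h4 : ∀ x : σ → F, ∏ j, (1 - L j x ^ K) =
        ∑ t ∈ (Finset.univ : Finset J).powerset, (-1) ^ t.card * ∏ j : t, L j x ^ K := by
      intro x
      simp only [sub_eq_neg_add]
      rw [Finset.prod_add]
      refine Finset.sum_congr rfl fun t _ => ?_
      rw [Finset.prod_const_one, mul_one, Finset.prod_neg, Finset.prod_coe_sort t fun j => L j x ^ K]
    rw [Finset.sum_congr rfl fun x _ => h4 x, Finset.sum_comm]
    refine Finset.dvd_sum fun t _ => ?_
    rw [← Finset.mul_sum]
    refine Dvd.dvd.mul_left (pow_dvd_sum_prod_teichmullerEval_pow hk hq (fun j : t => f j) ?_) _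
    rw [Finset.sum_coe_sort t fun j => (f j).totalDegree]
    exact (Finset.sum_le_sum_of_subset (Finset.subset_univ t)).trans_lt hf
  rw [h1]
  exact (dvd_sub_left h3).1 h2

/-! ### Determinants of bordered matrices -/

open Matrix

theorem map_fromBlocks_zero {R S κ : Type*} [CommRing R] [CommRing S] (f : R →+* S)
    (X : Matrix (Fin 2) (Fin 2) R) :
    (fromBlocks X 0 0 0 : Matrix (Fin 2 ⊕ κ) (Fin 2 ⊕ κ) R).map f =
      fromBlocks (X.map f) 0 0 0 := by
  ext (i | i) (j | j) <;> simp

section Bordered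

variable {κ : Type*} [Fintype κ] [DecidableEq κ]

/-- The principal minor of `K` on the indices `κ`. -/
def innerDet {R : Type*} [CommRing R] (K : Matrix (Fin 2 ⊕ κ) (Fin 2 ⊕ κ) R) : R :=
  (K.submatrix Sum.inr Sum.inr).det

/-- The minor of `K` on the rows `κ` and `i` and the columns `κ` and `j`. -/
def borderedDet {R : Type*} [CommRing R] (K : Matrix (Fin 2 ⊕ κ) (Fin 2 ⊕ κ) R) (i j : Fin 2) : R :=
  (K.submatrix (Sum.map (fun _ : Unit => i) id) (Sum.map (fun _ : Unit => j) id)).det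

theorem map_innerDet {R S : Type*} [CommRing R] [CommRing S] (f : R →+* S)
    (K : Matrix (Fin 2 ⊕ κ) (Fin 2 ⊕ κ) R) : f (innerDet K) = innerDet (K.map f) := by
  rw [innerDet, RingHom.map_det]
  rfl

theorem map_borderedDet {R S : Type*} [CommRing R] [CommRing S] (f : R →+* S)
    (K : Matrix (Fin 2 ⊕ κ) (Fin 2 ⊕ κ) R) (i j : Fin 2) :
    f (borderedDet K i j) = borderedDet (K.map f) i j := by
  rw [borderedDet, RingHom.map_det]
  rfl

/-- The identity of Desnanot and Jacobi, and the expansion of a determinant in its upper left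
block, when the lower right block is invertible: both are read off from the Schur complement. -/
theorem det_bordered_of_innerDet_ne_zero {L : Type*} [Field L]
    (K : Matrix (Fin 2 ⊕ κ) (Fin 2 ⊕ κ) L) (X : Matrix (Fin 2) (Fin 2) L) (h : innerDet K ≠ 0) :
    innerDet K * K.det =
      borderedDet K 0 0 * borderedDet K 1 1 - borderedDet K 0 1 * borderedDet K 1 0 ∧
    (K + fromBlocks X 0 0 0).det = K.det + X 0 0 * borderedDet K 1 1 + X 1 1 * borderedDet K 0 0 -
      X 0 1 * borderedDet K 1 0 - X 1 0 * borderedDet K 0 1 +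
      (X 0 0 * X 1 1 - X 0 1 * X 1 0) * innerDet K := by
  set A := K.toBlocks₁₁
  set B := K.toBlocks₁₂
  set C := K.toBlocks₂₁
  set D := K.toBlocks₂₂ with hD
  have hK : K = fromBlocks A B C D := (fromBlocks_toBlocks K).symm
  have hd : innerDet K = D.det := rfl
  have hu : IsUnit D := (Matrix.isUnit_iff_isUnit_det D).2 (hd ▸ h.isUnit)
  obtain ⟨hinv⟩ := hu.nonempty_invertible
  set Y : Matrix (Fin 2) (Fin 2) L := A - B * ⅟D * C with hY
  have h1 : ∀ X : Matrix (Fin 2) (Fin 2) L, (K + fromBlocks X 0 0 0).det = D.det * (Y + X).det := by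
    intro X
    rw [hK, fromBlocks_add, add_zero, add_zero, add_zero, det_fromBlocks₂₂, hY]
    congr 2
    abel
  have h2 : ∀ i j, borderedDet K i j = D.det * Y i j := by
    intro i j
    have h3 : K.submatrix (Sum.map (fun _ : Unit => i) id) (Sum.map (fun _ : Unit => j) id) =
        fromBlocks (A.submatrix (fun _ : Unit => i) fun _ : Unit => j)
          (B.submatrix (fun _ : Unit => i) id) (C.submatrix id fun _ : Unit => j) D := by
      ext (a | a) (b | b) <;> rfl
    rw [borderedDet, h3, det_fromBlocks₂₂]
    congr 1
    rw [det_unique]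
    rfl
  have h0 := h1 0
  rw [fromBlocks_zero, add_zero, add_zero] at h0
  rw [h1, h0, hd, h2, h2, h2, h2, det_fin_two, det_fin_two]
  simp only [Matrix.add_apply]
  constructor <;> ring

/-- The generic perturbation `K + t` of the lower right block of `K` by a scalar matrix. -/
noncomputable def scalarPerturb {F : Type*} [Field F] (K : Matrix (Fin 2 ⊕ κ) (Fin 2 ⊕ κ) F) :
    Matrix (Fin 2 ⊕ κ) (Fin 2 ⊕ κ) (Polynomial F) :=
  K.map Polynomial.C + fromBlocks 0 0 0 (scalar κ Polynomial.X)

theorem innerDet_scalarPerturb_ne_zero {F : Type*} [Field F]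
    (K : Matrix (Fin 2 ⊕ κ) (Fin 2 ⊕ κ) F) : innerDet (scalarPerturb K) ≠ 0 := by
  have h : innerDet (scalarPerturb K) = (-(K.submatrix Sum.inr Sum.inr)).charpoly := by
    rw [innerDet, Matrix.charpoly, Matrix.charmatrix]
    congr 1
    ext i j
    simp [scalarPerturb, add_comm]
  rw [h]
  exact (Matrix.charpoly_monic _).ne_zero

theorem scalarPerturb_eval_zero {F : Type*} [Field F] (K : Matrix (Fin 2 ⊕ κ) (Fin 2 ⊕ κ) F) :
    (scalarPerturb K).map (Polynomial.evalRingHom 0) = K := by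
  ext (i | i) (j | j) <;> simp [scalarPerturb, Matrix.scalar_apply, Matrix.diagonal_apply]
  split_ifs <;> simp

/-- The identity of Desnanot and Jacobi, and the expansion of a determinant in its upper left
block. -/
theorem det_bordered {F : Type*} [Field F]
    (K : Matrix (Fin 2 ⊕ κ) (Fin 2 ⊕ κ) F) (X : Matrix (Fin 2) (Fin 2) F) :
    innerDet K * K.det =
      borderedDet K 0 0 * borderedDet K 1 1 - borderedDet K 0 1 * borderedDet K 1 0 ∧
    (K + fromBlocks X 0 0 0).det = K.det + X 0 0 * borderedDet K 1 1 + X 1 1 * borderedDet K 0 0 -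
      X 0 1 * borderedDet K 1 0 - X 1 0 * borderedDet K 0 1 +
      (X 0 0 * X 1 1 - X 0 1 * X 1 0) * innerDet K := by
  set P := scalarPerturb K with hP
  set Z : Matrix (Fin 2) (Fin 2) (Polynomial F) := X.map Polynomial.C with hZ
  set f : Polynomial F →+* FractionRing (Polynomial F) := algebraMap _ _ with hf
  have hinj : Function.Injective f := IsFractionRing.injective _ _
  -- the lower right block of the perturbed matrix is invertible over `F(t)`; specialise to `t = 0`
  have h0 : innerDet (P.map f) ≠ 0 := by
    rw [← map_innerDet]
    exact fun h => innerDet_scalarPerturb_ne_zero K (hinj (h.trans (map_zero f).symm))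
  obtain ⟨h1, h2⟩ := det_bordered_of_innerDet_ne_zero (P.map f) (Z.map f) h0
  have hmapP : (P.map f).det = f P.det := (RingHom.map_det f P).symm
  have hmapS : (P.map f + fromBlocks (Z.map f) 0 0 0).det = f (P + fromBlocks Z 0 0 0).det := by
    rw [RingHom.map_det, map_add, RingHom.mapMatrix_apply, RingHom.mapMatrix_apply,
      map_fromBlocks_zero]
  rw [hmapP] at h1 h2
  rw [hmapS] at h2
  simp only [← map_innerDet, ← map_borderedDet, Matrix.map_apply, ← map_mul, ← map_add,
    ← map_sub] at h1 h2
  have h3 := congrArg (Polynomial.evalRingHom 0) (hinj h1)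
  have h4 := congrArg (Polynomial.evalRingHom 0) (hinj h2)
  simp only [map_innerDet, map_borderedDet, map_mul, map_add, map_sub, RingHom.map_det,
    RingHom.mapMatrix_apply, map_fromBlocks_zero] at h3 h4
  rw [scalarPerturb_eval_zero] at h3 h4
  have h5 : Z.map (Polynomial.evalRingHom 0) = X := by
    ext i j
    simp [hZ]
  have h6 : ∀ i j, (Polynomial.evalRingHom 0) (Z i j) = X i j := by
    intro i j
    simp [hZ]
  rw [h5] at h4
  simp only [h6] at h4
  exact ⟨h3, h4⟩

end Bordered

/-! ### Families of quadratic forms of rank one -/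

/-- The Gram matrix `∑_e α_e b_e b_eᵀ`. -/
def gram {R σ ι : Type*} [CommRing R] [Fintype σ] (b : σ → ι → R) (α : σ → R) : Matrix ι ι R :=
  Matrix.of fun i j => ∑ e, α e * (b e i * b e j)

/-- The number of parameters `α` for which `∑_e α_e b_e b_eᵀ` is degenerate. -/
noncomputable def degenCount {F σ ι : Type*} [Field F] [Fintype σ] [Fintype ι] [DecidableEq ι]
    (b : σ → ι → F) : ℕ :=
  Nat.card {α : σ → F // (gram b α).det = 0}

section Gram

variable {F σ ι : Type*} [Field F] [Fintype σ]

theorem gram_map {R S : Type*} [CommRing R] [CommRing S] (f : R →+* S) (b : σ → ι → R)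
    (α : σ → R) : (gram b α).map f = gram (fun e i => f (b e i)) (fun e => f (α e)) := by
  ext i j
  simp [gram]

theorem gram_transpose (b : σ → ι → F) (α : σ → F) : (gram b α)ᵀ = gram b α := by
  ext i j
  simp only [gram, Matrix.transpose_apply, Matrix.of_apply]
  exact Finset.sum_congr rfl fun e _ => by ring

theorem gram_sum {σ₁ σ₂ : Type*} [Fintype σ₁] [Fintype σ₂] (b : σ₁ ⊕ σ₂ → ι → F)
    (α : σ₁ ⊕ σ₂ → F) :
    gram b α = gram (fun e => b (Sum.inl e)) (fun e => α (Sum.inl e)) +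
      gram (fun e => b (Sum.inr e)) (fun e => α (Sum.inr e)) := by
  ext i j
  simp [gram, Fintype.sum_sum_type]

/-- The Gram matrix, in the coordinates of a basis, is singular if and only if some nonzero linear
form is in the radical of the quadratic form `∑_e α_e b_e²` on the dual space. -/
theorem det_gram_repr_eq_zero_iff [Fintype ι] [DecidableEq ι] {V : Type*} [AddCommGroup V]
    [Module F V] (β : Module.Basis ι F V) (b : σ → V) (α : σ → F) :
    (gram (fun e i => β.repr (b e) i) α).det = 0 ↔
      ∃ φ : V →ₗ[F] F, φ ≠ 0 ∧ ∑ e, (α e * φ (b e)) • b e = 0 := by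
  rw [← Matrix.exists_mulVec_eq_zero_iff]
  have key : ∀ w : ι → F, (gram (fun e i => β.repr (b e) i) α *ᵥ w = 0 ↔
      ∑ e, (α e * β.constr F w (b e)) • b e = 0) := by
    intro w
    rw [← β.repr.map_eq_zero_iff, map_sum, funext_iff, DFunLike.ext_iff]
    refine forall_congr' fun i => ?_
    simp only [Matrix.mulVec, dotProduct, gram, Matrix.of_apply, Pi.zero_apply,
      Finsupp.coe_finsetSum, Finset.sum_apply, map_smul, Finsupp.smul_apply, smul_eq_mul,
      Finsupp.coe_zero, Module.Basis.constr_apply_fintype, Module.Basis.equivFun_apply]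
    rw [show (∑ j, (∑ e, α e * (β.repr (b e) i * β.repr (b e) j)) * w j) =
      ∑ e, (α e * ∑ j, β.repr (b e) j * w j) * β.repr (b e) i from ?_]
    simp only [Finset.sum_mul, Finset.mul_sum]
    rw [Finset.sum_comm]
    exact Finset.sum_congr rfl fun e _ => Finset.sum_congr rfl fun j _ => by ring
  constructor
  · rintro ⟨w, hw, h⟩
    refine ⟨β.constr F w, ?_, (key w).1 h⟩
    exact fun h0 => hw ((β.constr F).map_eq_zero_iff.1 h0)
  · rintro ⟨φ, hφ, h⟩
    have h1 : β.constr F (fun i => φ (β i)) = φ := β.constr_self F φ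
    refine ⟨fun i => φ (β i), ?_, (key _).2 (by rwa [h1])⟩
    intro h0
    rw [h0, map_zero] at h1
    exact hφ h1.symm

variable [Fintype ι] [DecidableEq ι]

/-- Degeneracy does not depend on the choice of coordinates. -/
theorem degenCount_repr {ι' : Type*} [Fintype ι'] [DecidableEq ι'] (β : Module.Basis ι' F (ι → F))
    (b : σ → ι → F) : degenCount (fun e i => β.repr (b e) i) = degenCount b := by
  unfold degenCount
  refine Nat.card_congr (Equiv.subtypeEquivRight fun α => ?_)
  rw [det_gram_repr_eq_zero_iff, ← det_gram_repr_eq_zero_iff (Pi.basisFun F ι)]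
  rfl

theorem degenCount_reindex {σ' : Type*} [Fintype σ'] (ε : σ' ≃ σ) (b : σ → ι → F) :
    degenCount (fun e => b (ε e)) = degenCount b := by
  unfold degenCount
  refine Nat.card_congr ((ε.arrowCongr (Equiv.refl F)).subtypeEquiv fun α => ?_)
  have : gram (fun e => b (ε e)) α = gram b (ε.arrowCongr (Equiv.refl F) α) := by
    ext i j
    simp only [gram, Matrix.of_apply]
    exact Fintype.sum_equiv ε _ _ fun e => by simp
  rw [this]

theorem degenCount_smul (b : σ → ι → F) (s : σ → F) (hs : ∀ e, s e * s e = 1) :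
    degenCount (fun e => s e • b e) = degenCount b := by
  unfold degenCount
  refine Nat.card_congr (Equiv.subtypeEquivRight fun α => ?_)
  have : gram (fun e => s e • b e) α = gram b α := by
    ext i j
    simp only [gram, Matrix.of_apply, Pi.smul_apply, smul_eq_mul]
    refine Finset.sum_congr rfl fun e _ => ?_
    rw [show s e * b e i * (s e * b e j) = (s e * s e) * (b e i * b e j) by ring, hs, one_mul]
  rw [this]

theorem degenCount_eq_zero [IsEmpty ι] (b : σ → ι → F) : degenCount b = 0 := by
  unfold degenCount
  have : IsEmpty {α : σ → F // (gram b α).det = 0} := ⟨fun α => by simpa using α.2⟩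
  exact Nat.card_of_isEmpty

/-- If `b_e` is a multiple of another vector `b_f`, the parameter `α_e` can be absorbed in `α_f`. -/
theorem degenCount_eq_card_mul [Fintype F] [DecidableEq σ] (b : σ → ι → F) {e f : σ} (hef : f ≠ e)
    (c : F) (h : b e = c • b f) :
    degenCount b = Fintype.card F * degenCount (fun x : {x // x ≠ e} => b x) := by
  have key : ∀ (x : F) (y : {x // x ≠ e} → F),
      gram b ((Equiv.funSplitAt e F).symm (x, y)) =
        gram (fun x : {x // x ≠ e} => b x) (y + Pi.single ⟨f, hef⟩ (c * c * x)) := by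
    intro x y
    ext i j
    simp only [gram, Matrix.of_apply]
    rw [Fintype.sum_eq_add_sum_subtype_ne _ e]
    simp only [Pi.add_apply, add_mul, Finset.sum_add_distrib]
    rw [add_comm]
    congr 1
    · refine Finset.sum_congr rfl fun a _ => ?_
      congr 1
      simp [Equiv.funSplitAt, Equiv.piSplitAt, a.2]
    · rw [Finset.sum_eq_single ⟨f, hef⟩]
      · simp [Equiv.funSplitAt, Equiv.piSplitAt, h]
        ring
      · intro a _ ha
        rw [Pi.single_eq_of_ne ha, zero_mul]
      · exact fun h => absurd (Finset.mem_univ _) h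
  unfold degenCount
  rw [← Nat.card_eq_fintype_card (α := F), ← Nat.card_prod]
  let ψ : F × ({x // x ≠ e} → F) ≃ F × ({x // x ≠ e} → F) :=
    Equiv.prodShear (Equiv.refl F) fun x => Equiv.addRight (Pi.single ⟨f, hef⟩ (c * c * x))
  calc Nat.card {α : σ → F // (gram b α).det = 0}
      = Nat.card {p : F × ({x // x ≠ e} → F) //
          (gram (fun x : {x // x ≠ e} => b x) p.2).det = 0} := by
        refine Nat.card_congr (((Equiv.funSplitAt e F).trans ψ).subtypeEquiv fun α => ?_)
        have h1 := key (Equiv.funSplitAt e F α).1 (Equiv.funSplitAt e F α).2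
        rw [Prod.mk.eta, Equiv.symm_apply_apply] at h1
        rw [h1]
        rfl
    _ = _ := by
        refine Nat.card_congr
          { toFun := fun p => (p.1.1, ⟨p.1.2, p.2⟩)
            invFun := fun p => ⟨(p.1, p.2.1), p.2.2⟩
            left_inv := fun _ => rfl
            right_inv := fun _ => rfl }

end Gram

/-! ### Degrees of minors of Gram matrices -/

theorem totalDegree_det_le {F σ n : Type*} [Field F] [Fintype n] [DecidableEq n]
    (A : Matrix n n (MvPolynomial σ F)) (hA : ∀ i j, (A i j).totalDegree ≤ 1) :
    A.det.totalDegree ≤ Fintype.card n := by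
  rw [Matrix.det_apply]
  refine MvPolynomial.totalDegree_finsetSum_le fun τ _ => ?_
  have h1 : (∏ i, A (τ i) i).totalDegree ≤ Fintype.card n := by
    refine (MvPolynomial.totalDegree_finsetProd _ _).trans ?_
    refine (Finset.sum_le_sum fun i _ => hA (τ i) i).trans ?_
    simp
  rcases Int.units_eq_one_or (Equiv.Perm.sign τ) with h | h <;> rw [h]
  · rwa [one_smul]
  · rwa [Units.neg_smul, one_smul, MvPolynomial.totalDegree_neg]

section GramPoly

variable {F σ ι : Type*} [Field F] [Fintype σ]

/-- The Gram matrix `∑_e α_e b_e b_eᵀ` with indeterminate coefficients `α_e`. -/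
noncomputable def gramPoly (b : σ → ι → F) : Matrix ι ι (MvPolynomial σ F) :=
  gram (fun e i => MvPolynomial.C (b e i)) MvPolynomial.X

theorem gramPoly_totalDegree_le (b : σ → ι → F) (i j : ι) : (gramPoly b i j).totalDegree ≤ 1 := by
  rw [gramPoly, gram, Matrix.of_apply]
  refine MvPolynomial.totalDegree_finsetSum_le fun e _ => ?_
  refine (MvPolynomial.totalDegree_mul _ _).trans ?_
  rw [← MvPolynomial.C_mul, MvPolynomial.totalDegree_C, MvPolynomial.totalDegree_X]

theorem gramPoly_map_eval (b : σ → ι → F) (y : σ → F) :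
    (gramPoly b).map (MvPolynomial.eval y) = gram b y := by
  rw [gramPoly, gram_map]
  simp

theorem card_dvd_degenCount [Fintype F] [Fintype ι] [DecidableEq ι] (b : σ → ι → F)
    (h : Fintype.card ι < Fintype.card σ) : Fintype.card F ∣ degenCount b := by
  have h1 := card_dvd_card_solutions (fun _ : Unit => (gramPoly b).det) (by
    rw [Fintype.sum_unique]
    exact (totalDegree_det_le _ (gramPoly_totalDegree_le b)).trans_lt h)
  convert h1 using 1
  refine Nat.card_congr (Equiv.subtypeEquivRight fun y => ?_)
  rw [RingHom.map_det, RingHom.mapMatrix_apply, gramPoly_map_eval]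
  simp

variable {κ : Type*} [Fintype κ] [DecidableEq κ]

theorem innerDet_gramPoly_totalDegree_le (b : σ → Fin 2 ⊕ κ → F) :
    (innerDet (gramPoly b)).totalDegree ≤ Fintype.card κ :=
  totalDegree_det_le _ fun _ _ => gramPoly_totalDegree_le b _ _

theorem borderedDet_gramPoly_totalDegree_le (b : σ → Fin 2 ⊕ κ → F) (i j : Fin 2) :
    (borderedDet (gramPoly b) i j).totalDegree ≤ Fintype.card κ + 1 := by
  refine (totalDegree_det_le _ fun _ _ => gramPoly_totalDegree_le b _ _).trans ?_
  simp [add_comm]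

theorem borderedDet_gram_comm (b : σ → Fin 2 ⊕ κ → F) (y : σ → F) :
    borderedDet (gram b y) 1 0 = borderedDet (gram b y) 0 1 := by
  rw [borderedDet, ← Matrix.det_transpose, Matrix.transpose_submatrix, gram_transpose]
  rfl

theorem innerDet_mul_det_gram (b : σ → Fin 2 ⊕ κ → F) (y : σ → F) :
    innerDet (gram b y) * (gram b y).det =
      borderedDet (gram b y) 0 0 * borderedDet (gram b y) 1 1 - borderedDet (gram b y) 0 1 ^ 2 := by
  rw [(det_bordered (gram b y) 0).1, borderedDet_gram_comm]
  ring

variable [Fintype F] [DecidableEq F] [DecidableEq σ]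

theorem card_dvd_card_borderedDet (b : σ → Fin 2 ⊕ κ → F) (i j : Fin 2)
    (h : Fintype.card κ + 1 < Fintype.card σ) :
    Fintype.card F ∣ (Finset.univ.filter fun y : σ → F => borderedDet (gram b y) i j = 0).card := by
  have h1 := card_dvd_card_solutions (fun _ : Unit => borderedDet (gramPoly b) i j) (by
    rw [Fintype.sum_unique]
    exact (borderedDet_gramPoly_totalDegree_le b i j).trans_lt h)
  rw [Nat.card_eq_fintype_card, Fintype.card_subtype] at h1
  simpa only [map_borderedDet, gramPoly_map_eval, forall_const] using h1

theorem card_dvd_card_innerDet_borderedDet (b : σ → Fin 2 ⊕ κ → F) (i j : Fin 2)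
    (h : 2 * Fintype.card κ + 1 < Fintype.card σ) :
    Fintype.card F ∣ (Finset.univ.filter fun y : σ → F =>
      innerDet (gram b y) = 0 ∧ borderedDet (gram b y) i j = 0).card := by
  have h1 := card_dvd_card_solutions
    (fun t : Fin 2 => if t = 0 then innerDet (gramPoly b) else borderedDet (gramPoly b) i j) (by
      rw [Fin.sum_univ_two, if_pos rfl, if_neg one_ne_zero]
      have := borderedDet_gramPoly_totalDegree_le b i j
      have := innerDet_gramPoly_totalDegree_le b
      omega)
  rw [Nat.card_eq_fintype_card, Fintype.card_subtype] at h1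
  simpa only [Fin.forall_fin_two, if_true, one_ne_zero, if_false, map_borderedDet, map_innerDet,
    gramPoly_map_eval] using h1

/-- All coefficients of the expansion of the determinant in the upper left block, except for the
constant one, vanish. -/
def BorderedVanish {R : Type*} [CommRing R] (K : Matrix (Fin 2 ⊕ κ) (Fin 2 ⊕ κ) R) : Prop :=
  innerDet K = 0 ∧ borderedDet K 0 0 = 0 ∧ borderedDet K 1 1 = 0 ∧ borderedDet K 0 1 = 0

instance (K : Matrix (Fin 2 ⊕ κ) (Fin 2 ⊕ κ) F) : Decidable (BorderedVanish K) := by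
  unfold BorderedVanish
  infer_instance

/-- On `innerDet = 0`, the identity of Desnanot and Jacobi `m₀₀ m₁₁ = m₀₁²` shows that the locus
`m₀₁ = 0` is the union of `m₀₀ = 0` and `m₁₁ = 0`.  Hence the points in the intersection of the
latter two can be counted with systems of two equations, to which the Ax–Katz theorem applies. -/
theorem card_dvd_card_borderedVanish (b : σ → Fin 2 ⊕ κ → F)
    (h : 2 * Fintype.card κ + 1 < Fintype.card σ) :
    Fintype.card F ∣ (Finset.univ.filter fun y : σ → F => BorderedVanish (gram b y)).card := by
  set S : Fin 2 → Fin 2 → Finset (σ → F) := fun i j => Finset.univ.filter fun y : σ → F =>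
      innerDet (gram b y) = 0 ∧ borderedDet (gram b y) i j = 0 with hS
  have hunion : S 0 0 ∪ S 1 1 = S 0 1 := by
    ext y
    simp only [hS, Finset.mem_union, Finset.mem_filter, Finset.mem_univ, true_and, ← and_or_left]
    refine and_congr_right fun h0 => ?_
    have := innerDet_mul_det_gram b y
    rw [h0, zero_mul, eq_comm, sub_eq_zero] at this
    rw [← mul_eq_zero, this, sq_eq_zero_iff]
  have hinter : S 0 0 ∩ S 1 1 = Finset.univ.filter fun y : σ → F => BorderedVanish (gram b y) := by
    ext y
    rw [Finset.mem_filter_univ, BorderedVanish]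
    simp only [hS, Finset.mem_inter, Finset.mem_filter, Finset.mem_univ, true_and]
    constructor
    · rintro ⟨⟨h0, h1⟩, -, h2⟩
      have := innerDet_mul_det_gram b y
      rw [h0, h1, zero_mul, zero_mul, zero_sub, eq_comm, neg_eq_zero, sq_eq_zero_iff] at this
      exact ⟨h0, h1, h2, this⟩
    · rintro ⟨h0, h1, h2, -⟩
      exact ⟨⟨h0, h1⟩, h0, h2⟩
  rw [← hinter]
  have h1 := Finset.card_union_add_card_inter (S 0 0) (S 1 1)
  rw [hunion] at h1
  have h2 := card_dvd_card_innerDet_borderedDet b 0 0 h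
  have h3 := card_dvd_card_innerDet_borderedDet b 1 1 h
  have h4 := card_dvd_card_innerDet_borderedDet b 0 1 h
  exact (Nat.dvd_add_right h4).1 (h1 ▸ Nat.dvd_add h2 h3)

end GramPoly

/-! ### Counting points of small quadrics -/

section Quadrics

theorem card_subtype_of_existsUnique {A B : Type*} (P : A → B → Prop)
    (h : ∀ b, ∃! a, P a b) : Nat.card {p : A × B // P p.1 p.2} = Nat.card B := by
  choose f hf hf' using fun b => (h b)
  refine Nat.card_congr
    { toFun := fun p => p.1.2
      invFun := fun b => ⟨(f b, b), hf b⟩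
      left_inv := fun p => Subtype.ext (Prod.ext (hf' p.1.2 p.1.1 p.2).symm rfl)
      right_inv := fun _ => rfl }

theorem card_subtype_prod {A B : Type*} [Fintype A] [Fintype B] (P : A → B → Prop) :
    Nat.card {p : A × B // P p.1 p.2} = ∑ b, Nat.card {a // P a b} := by
  classical
  simp only [Nat.card_eq_fintype_card, Fintype.card_subtype, Finset.card_filter]
  rw [Fintype.sum_prod_type_right]

variable {F : Type*} [Field F]

theorem existsUnique_linear {u v : F} (hu : u ≠ 0) : ∃! x : F, u * x + v = 0 := by
  refine ⟨-v / u, by field_simp; ring, fun y hy => ?_⟩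
  field_simp
  linear_combination hy

variable [Fintype F]

theorem card_mul_eq_zero :
    (Nat.card {p : F × F // p.1 * p.2 = 0} : ℤ) = 2 * Fintype.card F - 1 := by
  classical
  rw [card_subtype_prod fun x z : F => x * z = 0, Nat.cast_sum,
    ← Finset.add_sum_erase _ _ (Finset.mem_univ (0 : F))]
  have h : ∀ z ∈ Finset.univ.erase (0 : F), ((Nat.card {x : F // x * z = 0} : ℕ) : ℤ) = 1 := by
    intro z hz
    have hz := Finset.ne_of_mem_erase hz
    have : ({x : F | x * z = 0}) = {0} := by
      ext x
      simp [hz]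
    rw [Nat.cast_eq_one]
    exact (Nat.card_congr (Equiv.setCongr this)).trans (by simp)
  rw [Finset.sum_congr rfl h]
  have := Fintype.card_pos (α := F)
  simp [Finset.card_erase_of_mem]
  rw [Nat.cast_sub this]
  push_cast
  ring

theorem card_mul_eq_of_ne_zero {w : F} (hw : w ≠ 0) :
    (Nat.card {p : F × F // p.1 * p.2 = w} : ℤ) = Fintype.card F - 1 := by
  have h : Nat.card {p : F × F // p.1 * p.2 = w} = Nat.card Fˣ := by
    refine Nat.card_congr
      { toFun := fun p => Units.mk0 p.1.2 (right_ne_zero_of_mul (p.2.trans_ne hw))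
        invFun := fun u => ⟨(w * (u⁻¹ : Fˣ), u), by simp⟩
        left_inv := fun p => ?_
        right_inv := fun u => by ext; rfl }
    obtain ⟨⟨x, z⟩, h⟩ := p
    have hz : z ≠ 0 := right_ne_zero_of_mul (h.trans_ne hw)
    ext
    · simp only [Units.val_inv_eq_inv_val, Units.val_mk0]
      rw [← h]
      field_simp
    · rfl
  rw [h, Nat.card_units, Nat.card_eq_fintype_card, Nat.cast_sub Fintype.card_pos]
  simp

variable [DecidableEq F]

/-- The number of zeros of `c + m₁ x + m₀ z + f x z`, whose coefficients are constrained by the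
identity of Desnanot and Jacobi. -/
theorem card_bilinear_eq (f m₀ m₁ m c : F) (h : f * c = m₀ * m₁ - m ^ 2) :
    (Nat.card {p : F × F // c + p.1 * m₁ + p.2 * m₀ + p.1 * p.2 * f = 0} : ℤ) =
      (Fintype.card F - 1) + (if f = 0 then 1 else 0) +
      Fintype.card F * ((if m = 0 then 1 else 0) - (if f = 0 ∧ m = 0 then 1 else 0) -
        (if f = 0 ∧ m₀ = 0 ∧ m₁ = 0 ∧ m = 0 then 1 else 0)) +
      Fintype.card F ^ 2 *
        (if (f = 0 ∧ m₀ = 0 ∧ m₁ = 0 ∧ m = 0) ∧ c = 0 then 1 else 0) := by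
  by_cases hf : f = 0
  · subst hf
    simp only [true_and, if_true]
    by_cases h1 : m₁ = 0
    · have hm : m = 0 := by
        rw [zero_mul, h1, mul_zero, zero_sub, eq_comm, neg_eq_zero, sq_eq_zero_iff] at h
        exact h
      by_cases h0 : m₀ = 0
      · by_cases hc : c = 0
        · simp [h1, h0, hm, hc, Nat.card_eq_fintype_card]
          ring
        · simp [h1, h0, hm, hc]
      · have := card_subtype_of_existsUnique
          (fun z x : F => c + x * m₁ + z * m₀ + x * z * 0 = 0) fun x => by
            obtain ⟨z, hz, hz'⟩ := existsUnique_linear (u := m₀) (v := c) h0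
            refine ⟨z, ?_, fun z' h' => hz' z' ?_⟩
            · simp only [h1]
              linear_combination hz
            · simp only [h1] at h' ⊢
              linear_combination h'
        have h2 : Nat.card {p : F × F // c + p.1 * m₁ + p.2 * m₀ + p.1 * p.2 * 0 = 0} =
            Fintype.card F := by
          rw [← Nat.card_eq_fintype_card, ← this]
          exact Nat.card_congr ((Equiv.prodComm F F).subtypeEquiv fun p => Iff.rfl)
        rw [h2]
        simp [h0, hm]
    · have := card_subtype_of_existsUnique
          (fun x z : F => c + x * m₁ + z * m₀ + x * z * 0 = 0) fun z => by
            obtain ⟨x, hx, hx'⟩ := existsUnique_linear (u := m₁) (v := c + z * m₀) h1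
            refine ⟨x, ?_, fun x' h' => hx' x' ?_⟩
            · linear_combination hx
            · linear_combination h'
      rw [this, Nat.card_eq_fintype_card]
      simp [h1]
  · have h2 : Nat.card {p : F × F // c + p.1 * m₁ + p.2 * m₀ + p.1 * p.2 * f = 0} =
        Nat.card {p : F × F // p.1 * p.2 = m ^ 2} := by
      let ψ : F ≃ F := Equiv.mulLeft₀ f hf
      refine Nat.card_congr (Equiv.subtypeEquiv ((ψ.trans (Equiv.addRight m₀)).prodCongr
        (ψ.trans (Equiv.addRight m₁))) fun p => ?_)
      obtain ⟨x, z⟩ := p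
      change c + x * m₁ + z * m₀ + x * z * f = 0 ↔ (f * x + m₀) * (f * z + m₁) = m ^ 2
      rw [← sub_eq_zero (b := m ^ 2), ← mul_right_inj' hf, mul_zero]
      rw [show f * (c + x * m₁ + z * m₀ + x * z * f) = (f * x + m₀) * (f * z + m₁) - m ^ 2 by
        linear_combination h]
    rw [h2]
    by_cases hm : m = 0
    · simp only [hm, ne_eq, OfNat.ofNat_ne_zero, not_false_eq_true, zero_pow]
      rw [card_mul_eq_zero]
      simp [hf]
      ring
    · rw [card_mul_eq_of_ne_zero (pow_ne_zero 2 hm)]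
      simp [hf, hm]

/-- The cone over a smooth conic has `q²` points. -/
theorem card_conic : Nat.card {p : F × F × F // p.1 * p.2.2 = p.2.1 ^ 2} = Fintype.card F ^ 2 := by
  classical
  have h1 : Nat.card {p : F × F × F // p.1 * p.2.2 = p.2.1 ^ 2} =
      Nat.card {p : (F × F) × F // p.1.1 * p.1.2 = p.2 ^ 2} :=
    Nat.card_congr (Equiv.subtypeEquiv
      { toFun := fun p => ((p.1, p.2.2), p.2.1)
        invFun := fun p => (p.1.1, p.2, p.1.2)
        left_inv := fun _ => rfl
        right_inv := fun _ => rfl } fun _ => Iff.rfl)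
  rw [h1, card_subtype_prod fun (p : F × F) (y : F) => p.1 * p.2 = y ^ 2]
  zify
  rw [← Finset.add_sum_erase _ _ (Finset.mem_univ (0 : F))]
  have h : ∀ y ∈ Finset.univ.erase (0 : F),
      ((Nat.card {p : F × F // p.1 * p.2 = y ^ 2} : ℕ) : ℤ) = Fintype.card F - 1 := fun y hy =>
    card_mul_eq_of_ne_zero (pow_ne_zero 2 (Finset.ne_of_mem_erase hy))
  rw [Finset.sum_congr rfl h]
  simp only [ne_eq, OfNat.ofNat_ne_zero, not_false_eq_true, zero_pow]
  rw [card_mul_eq_zero, Finset.sum_const, Finset.card_erase_of_mem (Finset.mem_univ _),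
    Finset.card_univ, nsmul_eq_mul, Nat.cast_sub Fintype.card_pos]
  push_cast
  ring

/-- The number of symmetric matrices `(x, y; y, z)` at which the expansion of a symmetric
determinant in its upper left block vanishes. -/
theorem card_quadric_eq (f m₀ m₁ m c : F) (h : f * c = m₀ * m₁ - m ^ 2) :
    (Nat.card {p : F × F × F //
        c + p.1 * m₁ + p.2.2 * m₀ - 2 * p.2.1 * m + (p.1 * p.2.2 - p.2.1 ^ 2) * f = 0} : ℤ) =
      Fintype.card F ^ 2 * (1 - (if f = 0 ∧ m₀ = 0 ∧ m₁ = 0 ∧ m = 0 then 1 else 0)) +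
      Fintype.card F ^ 3 *
        (if (f = 0 ∧ m₀ = 0 ∧ m₁ = 0 ∧ m = 0) ∧ c = 0 then 1 else 0) := by
  by_cases hf : f = 0
  · subst hf
    simp only [true_and, mul_zero, add_zero]
    by_cases h1 : m₁ = 0
    · have hm : m = 0 := by
        rw [zero_mul, h1, mul_zero, zero_sub, eq_comm, neg_eq_zero, sq_eq_zero_iff] at h
        exact h
      by_cases h0 : m₀ = 0
      · by_cases hc : c = 0
        · simp [h1, h0, hm, hc, Nat.card_eq_fintype_card]
          ring
        · simp [h1, h0, hm, hc]
      · have := card_subtype_of_existsUnique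
          (fun (z : F) (p : F × F) => c + p.1 * m₁ + z * m₀ - 2 * p.2 * m = 0) fun p => by
            obtain ⟨z, hz, hz'⟩ := existsUnique_linear (u := m₀) (v := c) h0
            refine ⟨z, ?_, fun z' h' => hz' z' ?_⟩
            · simp only [h1, hm]
              linear_combination hz
            · simp only [h1, hm] at h' ⊢
              linear_combination h'
        have h2 : Nat.card {p : F × F × F // c + p.1 * m₁ + p.2.2 * m₀ - 2 * p.2.1 * m = 0} =
            Fintype.card F ^ 2 := by
          rw [Nat.card_prod, Nat.card_eq_fintype_card (α := F), ← sq] at this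
          rw [← this]
          exact Nat.card_congr (Equiv.subtypeEquiv
            { toFun := fun p => (p.2.2, p.1, p.2.1)
              invFun := fun p => (p.2.1, p.2.2, p.1)
              left_inv := fun _ => rfl
              right_inv := fun _ => rfl } fun _ => Iff.rfl)
        rw [h2]
        simp [h0]
    · have := card_subtype_of_existsUnique
          (fun (x : F) (p : F × F) => c + x * m₁ + p.2 * m₀ - 2 * p.1 * m = 0) fun p => by
            obtain ⟨x, hx, hx'⟩ :=
              existsUnique_linear (u := m₁) (v := c + p.2 * m₀ - 2 * p.1 * m) h1
            refine ⟨x, ?_, fun x' h' => hx' x' ?_⟩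
            · linear_combination hx
            · linear_combination h'
      rw [this, Nat.card_prod, Nat.card_eq_fintype_card]
      simp [h1, sq]
  · have h2 : Nat.card {p : F × F × F //
          c + p.1 * m₁ + p.2.2 * m₀ - 2 * p.2.1 * m + (p.1 * p.2.2 - p.2.1 ^ 2) * f = 0} =
        Nat.card {p : F × F × F // p.1 * p.2.2 = p.2.1 ^ 2} := by
      let ψ : F ≃ F := Equiv.mulLeft₀ f hf
      refine Nat.card_congr (Equiv.subtypeEquiv ((ψ.trans (Equiv.addRight m₀)).prodCongr
        ((ψ.trans (Equiv.addRight m)).prodCongr (ψ.trans (Equiv.addRight m₁)))) fun p => ?_)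
      obtain ⟨x, y, z⟩ := p
      change c + x * m₁ + z * m₀ - 2 * y * m + (x * z - y ^ 2) * f = 0 ↔
        (f * x + m₀) * (f * z + m₁) = (f * y + m) ^ 2
      rw [← sub_eq_zero (b := (f * y + m) ^ 2), ← mul_right_inj' hf, mul_zero]
      rw [show f * (c + x * m₁ + z * m₀ - 2 * y * m + (x * z - y ^ 2) * f) =
        (f * x + m₀) * (f * z + m₁) - (f * y + m) ^ 2 by linear_combination h]
    rw [h2, card_conic]
    simp [hf]

end Quadrics

/-! ### Divisibility of numbers of degenerate quadratic forms -/

section Split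

variable {F : Type*} [Field F] [Fintype F] {σ κ : Type*} [Fintype σ] [Fintype κ] [DecidableEq κ]

theorem degenCount_sum {τ ι : Type*} [Fintype τ] [Fintype ι] [DecidableEq ι] [DecidableEq σ]
    (b : τ ⊕ σ → ι → F) :
    degenCount b = ∑ y : σ → F, Nat.card {x : τ → F // (gram (fun e => b (Sum.inr e)) y +
      gram (fun e => b (Sum.inl e)) x).det = 0} := by
  classical
  rw [← card_subtype_prod fun (x : τ → F) (y : σ → F) =>
    (gram (fun e => b (Sum.inr e)) y + gram (fun e => b (Sum.inl e)) x).det = 0]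
  refine Nat.card_congr ((Equiv.sumArrowEquivProdArrow τ σ F).subtypeEquiv fun α => ?_)
  rw [gram_sum, add_comm]
  rfl

variable [DecidableEq F] [DecidableEq σ]

/-- Two independent vectors `b_0`, `b_1` are split off from a family, and the degenerate forms are
counted with the two parameters of these vectors first. -/
theorem degenCount_split_two (b : Fin 2 ⊕ σ → Fin 2 ⊕ κ → F)
    (hb : ∀ i, b (Sum.inl i) = Pi.single (Sum.inl i) 1) :
    ∃ A : ℤ, (degenCount b : ℤ) =
      (Fintype.card F - 1) * Fintype.card F ^ Fintype.card σ +
      degenCount (fun (e : σ) (i : κ) => b (Sum.inr e) (Sum.inr i)) +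
      Fintype.card F * (
        (Finset.univ.filter fun y : σ → F =>
          borderedDet (gram (fun e => b (Sum.inr e)) y) 0 1 = 0).card -
        (Finset.univ.filter fun y : σ → F =>
          innerDet (gram (fun e => b (Sum.inr e)) y) = 0 ∧
          borderedDet (gram (fun e => b (Sum.inr e)) y) 0 1 = 0).card -
        (Finset.univ.filter fun y : σ → F =>
          BorderedVanish (gram (fun e => b (Sum.inr e)) y)).card) +
      Fintype.card F ^ 2 * A := by
  set b' : σ → Fin 2 ⊕ κ → F := fun e => b (Sum.inr e) with hb'
  have h1 : ∀ y : σ → F, Nat.card {x : Fin 2 → F // (gram b' y +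
      gram (fun e => b (Sum.inl e)) x).det = 0} =
      Nat.card {p : F × F // (gram b' y).det + p.1 * borderedDet (gram b' y) 1 1 +
        p.2 * borderedDet (gram b' y) 0 0 + p.1 * p.2 * innerDet (gram b' y) = 0} := by
    intro y
    refine Nat.card_congr ((finTwoArrowEquiv F).subtypeEquiv fun x => ?_)
    have h2 : gram (fun e => b (Sum.inl e)) x = fromBlocks (Matrix.diagonal x) 0 0 0 := by
      ext (i | i) (j | j)
      · fin_cases i <;> fin_cases j <;> simp [gram, hb, Pi.single_apply]
      · simp [gram, hb, Pi.single_apply]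
      · simp [gram, hb, Pi.single_apply]
      · simp [gram, hb, Pi.single_apply]
    rw [h2, (det_bordered _ _).2]
    simp
  have h0 : (degenCount (fun (e : σ) (i : κ) => b' e (Sum.inr i)) : ℤ) =
      ∑ y : σ → F, if innerDet (gram b' y) = 0 then 1 else 0 := by
    rw [degenCount, Nat.card_eq_fintype_card, Fintype.card_subtype, Finset.card_filter]
    push_cast
    rfl
  refine ⟨(Finset.univ.filter fun y : σ → F => (innerDet (gram b' y) = 0 ∧
    borderedDet (gram b' y) 0 0 = 0 ∧ borderedDet (gram b' y) 1 1 = 0 ∧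
    borderedDet (gram b' y) 0 1 = 0) ∧ (gram b' y).det = 0).card, ?_⟩
  rw [degenCount_sum, Finset.sum_congr rfl fun y _ => h1 y, Nat.cast_sum,
    Finset.sum_congr rfl fun y _ => card_bilinear_eq _ _ _ (borderedDet (gram b' y) 0 1) _
      (innerDet_mul_det_gram b' y), h0]
  simp only [Finset.sum_add_distrib, ← Finset.mul_sum, Finset.sum_sub_distrib, Finset.sum_const,
    Finset.card_univ, Fintype.card_fun, nsmul_eq_mul, Finset.sum_boole, BorderedVanish]
  push_cast
  ring

/-- Three vectors `b_0`, `b_1`, `- b_0 - b_1`, the first two of which are independent, are split off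
from a family, and the degenerate forms are counted with their three parameters first. -/
theorem degenCount_split_three (b : Fin 3 ⊕ σ → Fin 2 ⊕ κ → F)
    (h0 : b (Sum.inl 0) = Pi.single (Sum.inl 0) 1) (h1 : b (Sum.inl 1) = Pi.single (Sum.inl 1) 1)
    (h2 : b (Sum.inl 0) + b (Sum.inl 1) + b (Sum.inl 2) = 0) :
    ∃ A : ℤ, (degenCount b : ℤ) =
      Fintype.card F ^ 2 * (Fintype.card F ^ Fintype.card σ -
        (Finset.univ.filter fun y : σ → F =>
          BorderedVanish (gram (fun e => b (Sum.inr e)) y)).card) +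
      Fintype.card F ^ 3 * A := by
  set b' : σ → Fin 2 ⊕ κ → F := fun e => b (Sum.inr e) with hb'
  -- `(α₀, α₁, α₂) ↦ (α₀ + α₂, α₂, α₁ + α₂)` parametrises the symmetric matrices of size two
  let ψ : (Fin 3 → F) ≃ F × F × F :=
    { toFun := fun x => (x 0 + x 2, x 2, x 1 + x 2)
      invFun := fun p => ![p.1 - p.2.1, p.2.2 - p.2.1, p.2.1]
      left_inv := fun x => by
        ext i
        fin_cases i <;> simp
      right_inv := fun p => by simp }
  have h3 : ∀ y : σ → F, Nat.card {x : Fin 3 → F // (gram b' y +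
      gram (fun e => b (Sum.inl e)) x).det = 0} =
      Nat.card {p : F × F × F // (gram b' y).det + p.1 * borderedDet (gram b' y) 1 1 +
        p.2.2 * borderedDet (gram b' y) 0 0 - 2 * p.2.1 * borderedDet (gram b' y) 0 1 +
        (p.1 * p.2.2 - p.2.1 ^ 2) * innerDet (gram b' y) = 0} := by
    intro y
    refine Nat.card_congr (ψ.subtypeEquiv fun x => ?_)
    have h5 : b (Sum.inl 2) = -(Pi.single (Sum.inl 0) 1 + Pi.single (Sum.inl 1) 1) := by
      rw [← h0, ← h1]
      exact eq_neg_of_add_eq_zero_right h2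
    have h4 : gram (fun e => b (Sum.inl e)) x =
        fromBlocks !![x 0 + x 2, x 2; x 2, x 1 + x 2] 0 0 0 := by
      ext (i | i) (j | j)
      · fin_cases i <;> fin_cases j <;>
          simp [gram, h0, h1, h5, Fin.sum_univ_three, Pi.single_apply]
      · simp [gram, h0, h1, h5, Fin.sum_univ_three, Pi.single_apply]
      · simp [gram, h0, h1, h5, Fin.sum_univ_three, Pi.single_apply]
      · simp [gram, h0, h1, h5, Fin.sum_univ_three, Pi.single_apply]
    rw [h4, (det_bordered _ _).2, borderedDet_gram_comm]
    change _ ↔ (gram b' y).det + (x 0 + x 2) * borderedDet (gram b' y) 1 1 +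
        (x 1 + x 2) * borderedDet (gram b' y) 0 0 - 2 * x 2 * borderedDet (gram b' y) 0 1 +
        ((x 0 + x 2) * (x 1 + x 2) - x 2 ^ 2) * innerDet (gram b' y) = 0
    simp only [of_apply, cons_val', cons_val_zero, cons_val_one, empty_val', cons_val_fin_one]
    ring_nf
  refine ⟨(Finset.univ.filter fun y : σ → F => (innerDet (gram b' y) = 0 ∧
    borderedDet (gram b' y) 0 0 = 0 ∧ borderedDet (gram b' y) 1 1 = 0 ∧
    borderedDet (gram b' y) 0 1 = 0) ∧ (gram b' y).det = 0).card, ?_⟩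
  rw [degenCount_sum, Finset.sum_congr rfl fun y _ => h3 y, Nat.cast_sum,
    Finset.sum_congr rfl fun y _ => card_quadric_eq _ _ _ (borderedDet (gram b' y) 0 1) _
      (innerDet_mul_det_gram b' y)]
  simp only [Finset.sum_add_distrib, ← Finset.mul_sum, Finset.sum_sub_distrib, Finset.sum_const,
    Finset.card_univ, Fintype.card_fun, nsmul_eq_mul, Finset.sum_boole, BorderedVanish]
  push_cast
  ring

end Split

section Divisibility

variable {F : Type*} [Field F]

theorem exists_basis_extending {k l : ℕ} (hl : l = k + 2) (v : Fin 2 → Fin l → F)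
    (hv : LinearIndependent F v) :
    ∃ β : Module.Basis (Fin 2 ⊕ Fin k) F (Fin l → F), ∀ i, β (Sum.inl i) = v i := by
  have hfin : Finite (Module.Basis.sumExtendIndex hv) := by
    have := Module.Finite.finite_basis (Module.Basis.sumExtend hv)
    exact Finite.of_injective _ (Sum.inr_injective (α := Fin 2))
  have := Fintype.ofFinite (Module.Basis.sumExtendIndex hv)
  have hcard : Fintype.card (Module.Basis.sumExtendIndex hv) = k := by
    have h := Module.finrank_eq_card_basis (Module.Basis.sumExtend hv)
    rw [Module.finrank_fin_fun, Fintype.card_sum, Fintype.card_fin] at h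
    omega
  refine ⟨(Module.Basis.sumExtend hv).reindex
    (Equiv.sumCongr (Equiv.refl _) (Fintype.equivFinOfCardEq hcard)), fun i => ?_⟩
  simp [Module.Basis.sumExtend]
  rfl

/-- The members of a family `f : Fin m → σ` are separated from the rest of `σ`. -/
theorem exists_equiv_sum {σ : Type*} [Fintype σ] {m : ℕ} (f : Fin m → σ)
    (hf : Function.Injective f) :
    ∃ (σ' : Set σ) (ε : Fin m ⊕ σ' ≃ σ), ∀ i, ε (Sum.inl i) = f i := by
  classical
  refine ⟨(Set.range f)ᶜ, (Equiv.sumCongr (Equiv.ofInjective f hf) (Equiv.refl _)).trans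
    (Equiv.Set.sumCompl (Set.range f)), fun i => ?_⟩
  simp

variable [Fintype F]

/-- If all vectors lie in a line and the dimension is at least two, all forms are degenerate. -/
theorem degenCount_eq_pow_of_rank_le_one {σ : Type*} [Fintype σ] {l : ℕ} (hl : 2 ≤ l)
    (b : σ → Fin l → F) (h : ¬ ∃ e f, LinearIndependent F ![b e, b f]) :
    degenCount b = Fintype.card F ^ Fintype.card σ := by
  classical
  have hline : ∃ v : Fin l → F, ∀ e, ∃ c : F, b e = c • v := by
    by_cases h0 : ∃ e, b e ≠ 0
    · obtain ⟨e, he⟩ := h0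
      refine ⟨b e, fun f => ?_⟩
      push Not at h
      have h1 := h e f
      rw [LinearIndependent.pair_iff' he] at h1
      push Not at h1
      obtain ⟨c, hc⟩ := h1
      exact ⟨c, hc.symm⟩
    · push Not at h0
      exact ⟨0, fun e => ⟨0, by rw [h0, smul_zero]⟩⟩
  obtain ⟨v, hv⟩ := hline
  have hφ : ∃ φ : (Fin l → F) →ₗ[F] F, φ ≠ 0 ∧ φ v = 0 := by
    have hlt : Submodule.span F {v} < ⊤ := by
      refine lt_top_iff_ne_top.2 fun htop => ?_
      have h1 := finrank_span_le_card (R := F) ({v} : Set (Fin l → F))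
      rw [htop, finrank_top, Module.finrank_fin_fun] at h1
      simp at h1
      omega
    obtain ⟨φ, hφ, hle⟩ := Submodule.exists_le_ker_of_lt_top _ hlt
    exact ⟨φ, hφ, hle (Submodule.mem_span_singleton_self v)⟩
  obtain ⟨φ, hφ, hφv⟩ := hφ
  have hall : ∀ α : σ → F, (gram b α).det = 0 := by
    intro α
    refine (det_gram_repr_eq_zero_iff (Pi.basisFun F (Fin l)) b α).2 ⟨φ, hφ, ?_⟩
    refine Finset.sum_eq_zero fun e _ => ?_
    obtain ⟨c, hc⟩ := hv e
    rw [hc, map_smul, hφv, smul_zero, mul_zero, zero_smul]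
  rw [degenCount, Nat.card_eq_fintype_card, ← Fintype.card_fun, Fintype.card_subtype]
  simp [hall]

/-- If three vectors are multiples of one of them, two parameters can be absorbed. -/
theorem pow_dvd_degenCount_of_parallel {σ ι : Type*} [Fintype σ] [Fintype ι] [DecidableEq ι]
    (b : σ → ι → F) {e f g : σ} (hfe : f ≠ e) (hge : g ≠ e) (hgf : g ≠ f) {c d : F}
    (hf : b f = c • b e) (hg : b g = d • b e) :
    Fintype.card F ^ 2 ∣ degenCount b ∧
      (Fintype.card ι + 2 < Fintype.card σ → Fintype.card F ^ 3 ∣ degenCount b) := by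
  classical
  have h1 := degenCount_eq_card_mul b hfe.symm c hf
  have h2 := degenCount_eq_card_mul (fun x : {x // x ≠ f} => b x) (e := ⟨g, hgf⟩)
    (f := ⟨e, hfe.symm⟩) (fun h => hge (congrArg Subtype.val h).symm) d hg
  rw [h2, ← mul_assoc, ← sq] at h1
  rw [h1]
  refine ⟨dvd_mul_right _ _, fun h => ?_⟩
  rw [pow_succ _ 2]
  refine mul_dvd_mul_left _ (card_dvd_degenCount _ ?_)
  have h3 := Fintype.card_subtype_compl (fun x : σ => x = f)
  have h4 := Fintype.card_subtype_compl (fun x : {x // x ≠ f} => x = ⟨g, hgf⟩)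
  simp only [Fintype.card_subtype_eq] at h3 h4
  change Fintype.card {x : {x // x ≠ f} // x ≠ ⟨g, hgf⟩} = _ at h4
  change Fintype.card {x // x ≠ f} = _ at h3
  omega

/-- A family of at least `2 l` vectors in an `l`-dimensional space: the number of degenerate forms
is divisible by `q²`. -/
theorem sq_dvd_degenCount (l : ℕ) : ∀ {σ : Type*} [Fintype σ] (b : σ → Fin l → F),
    2 * l ≤ Fintype.card σ → (l = 0 ∨ 3 ≤ Fintype.card σ) →
    Fintype.card F ^ 2 ∣ degenCount b := by
  classical
  induction l using Nat.strong_induction_on with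
  | _ l ih =>
  intro σ _ b h1 h2
  rcases Nat.eq_zero_or_pos l with rfl | hl0
  · rw [degenCount_eq_zero]
    exact dvd_zero _
  have h3 : 3 ≤ Fintype.card σ := by omega
  rcases Nat.lt_or_ge l 2 with hl | hl
  · obtain rfl : l = 1 := by omega
    have hline : ∃ e, ∀ f, ∃ c : F, b f = c • b e := by
      by_cases h0 : ∃ e, b e ≠ 0
      · obtain ⟨e, he⟩ := h0
        have he0 : b e 0 ≠ 0 := fun h => he (funext fun i => by rwa [Subsingleton.elim i 0])
        refine ⟨e, fun f => ⟨b f 0 / b e 0, funext fun i => ?_⟩⟩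
        rw [Subsingleton.elim i 0, Pi.smul_apply, smul_eq_mul]
        field_simp
      · push Not at h0
        obtain ⟨e⟩ : Nonempty σ := Fintype.card_pos_iff.1 (by omega)
        exact ⟨e, fun f => ⟨0, by rw [h0, zero_smul]⟩⟩
    obtain ⟨e, he⟩ := hline
    obtain ⟨f, hf⟩ := Fintype.exists_ne_of_one_lt_card (by omega : 1 < Fintype.card σ) e
    obtain ⟨g, hg⟩ : ∃ g, g ∉ ({e, f} : Finset σ) := by
      by_contra hcon
      push Not at hcon
      have h4 : (Finset.univ : Finset σ) ⊆ {e, f} := fun x _ => hcon x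
      have h5 := (Finset.card_le_card h4).trans Finset.card_le_two
      rw [Finset.card_univ] at h5
      omega
    simp only [Finset.mem_insert, Finset.mem_singleton, not_or] at hg
    obtain ⟨c, hc⟩ := he f
    obtain ⟨d, hd⟩ := he g
    exact (pow_dvd_degenCount_of_parallel b hf hg.1 hg.2 hc hd).1
  by_cases hind : ∃ e f, LinearIndependent F ![b e, b f]
  · obtain ⟨e, f, hef⟩ := hind
    obtain ⟨k, hk⟩ := Nat.exists_eq_add_of_le' hl
    have hne : Function.Injective ![e, f] := by
      have h := hef.injective
      intro i j hij
      apply h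
      fin_cases i <;> fin_cases j <;> simp_all
    obtain ⟨σ', ε, hε⟩ := exists_equiv_sum ![e, f] hne
    obtain ⟨β, hβ⟩ := exists_basis_extending hk _ hef
    have hσ' : Fintype.card σ' + 2 = Fintype.card σ := by
      rw [← Fintype.card_congr ε, Fintype.card_sum, Fintype.card_fin, add_comm]
    set c : Fin 2 ⊕ σ' → Fin 2 ⊕ Fin k → F := fun x i => β.repr (b (ε x)) i with hc
    have hc1 : degenCount c = degenCount b := by
      rw [hc, degenCount_repr β fun x => b (ε x), degenCount_reindex]
    have hc2 : ∀ i, c (Sum.inl i) = Pi.single (Sum.inl i) 1 := by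
      intro i
      have : b (ε (Sum.inl i)) = β (Sum.inl i) := by
        rw [hε, hβ]
        fin_cases i <;> rfl
      ext j
      rw [hc]
      simp only [this, Module.Basis.repr_self, Finsupp.single_eq_pi_single]
    obtain ⟨A, hA⟩ := degenCount_split_two c hc2
    have hn0 := ih k (by omega) (fun (e : σ') (i : Fin k) => c (Sum.inr e) (Sum.inr i))
      (by omega) (by omega)
    have hm := card_dvd_card_borderedDet (fun e => c (Sum.inr e)) 0 1 (by
      rw [Fintype.card_fin]; omega)
    have hL := card_dvd_card_innerDet_borderedDet (fun e => c (Sum.inr e)) 0 1 (by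
      rw [Fintype.card_fin]; omega)
    have ha := card_dvd_card_borderedVanish (fun e => c (Sum.inr e)) (by
      rw [Fintype.card_fin]; omega)
    rw [← hc1]
    zify at hn0 hm hL ha ⊢
    rw [hA]
    refine dvd_add (dvd_add (dvd_add ?_ hn0) ?_) (dvd_mul_right _ _)
    · exact Dvd.dvd.mul_left (pow_dvd_pow _ (by omega)) _
    · rw [sq]
      exact mul_dvd_mul_left _ (dvd_sub (dvd_sub hm hL) ha)
  · rw [degenCount_eq_pow_of_rank_le_one hl b hind]
    exact pow_dvd_pow _ (by omega)

/-- If a vector is a multiple of another one, absorbing its parameter gains a factor `q` over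
`sq_dvd_degenCount`. -/
theorem cube_dvd_degenCount_of_parallel {σ : Type*} [Fintype σ] {l : ℕ} (hl : 0 < l)
    (b : σ → Fin l → F) (h1 : 2 * l < Fintype.card σ) (h2 : 4 ≤ Fintype.card σ) {e f : σ}
    (hef : f ≠ e) {c : F} (h : b e = c • b f) : Fintype.card F ^ 3 ∣ degenCount b := by
  classical
  rw [degenCount_eq_card_mul b hef c h, pow_succ']
  have h3 := Fintype.card_subtype_compl (fun x : σ => x = e)
  rw [Fintype.card_subtype_eq] at h3
  change Fintype.card {x // x ≠ e} = _ at h3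
  exact mul_dvd_mul_left _ (sq_dvd_degenCount l _ (by omega) (by omega))

/-- The count for the edges at a three-valent vertex: three distinct vectors with sum zero. -/
theorem cube_dvd_degenCount_of_add_eq_zero {σ : Type*} [Fintype σ] {l : ℕ}
    (b : σ → Fin l → F) (h1 : 2 * l < Fintype.card σ) (h2 : 4 ≤ Fintype.card σ) {u v w : σ}
    (huv : u ≠ v) (huw : u ≠ w) (hvw : v ≠ w) (h : b u + b v + b w = 0) :
    Fintype.card F ^ 3 ∣ degenCount b := by
  classical
  by_cases hind : LinearIndependent F ![b u, b v]
  · have hl : 2 ≤ l := by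
      have h3 := hind.fintype_card_le_finrank
      rwa [Module.finrank_fin_fun, Fintype.card_fin] at h3
    obtain ⟨k, hk⟩ := Nat.exists_eq_add_of_le' hl
    have hinj : Function.Injective ![u, v, w] := by
      intro i j hij
      fin_cases i <;> fin_cases j <;> simp_all [eq_comm]
    obtain ⟨σ', ε, hε⟩ := exists_equiv_sum ![u, v, w] hinj
    obtain ⟨β, hβ⟩ := exists_basis_extending hk _ hind
    have hσ' : Fintype.card σ' + 3 = Fintype.card σ := by
      rw [← Fintype.card_congr ε, Fintype.card_sum, Fintype.card_fin, add_comm]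
    have hε0 : ε (Sum.inl 0) = u := hε 0
    have hε1 : ε (Sum.inl 1) = v := hε 1
    have hε2 : ε (Sum.inl 2) = w := hε 2
    have hβ0 : b u = β (Sum.inl 0) := (hβ 0).symm
    have hβ1 : b v = β (Sum.inl 1) := (hβ 1).symm
    set c : Fin 3 ⊕ σ' → Fin 2 ⊕ Fin k → F := fun x i => β.repr (b (ε x)) i with hc
    have hc1 : degenCount c = degenCount b := by
      rw [hc, degenCount_repr β fun x => b (ε x), degenCount_reindex]
    obtain ⟨A, hA⟩ := degenCount_split_three c
      (by
        ext j
        rw [hc]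
        simp only [hε0, hβ0, Module.Basis.repr_self, Finsupp.single_eq_pi_single])
      (by
        ext j
        rw [hc]
        simp only [hε1, hβ1, Module.Basis.repr_self, Finsupp.single_eq_pi_single])
      (by
        ext j
        simp only [hc, hε0, hε1, hε2, Pi.add_apply, ← Finsupp.add_apply, ← map_add, h]
        simp)
    have ha := card_dvd_card_borderedVanish (fun e => c (Sum.inr e)) (by
      rw [Fintype.card_fin]; omega)
    rw [← hc1]
    zify at ha ⊢
    rw [hA]
    refine dvd_add ?_ (dvd_mul_right _ _)
    rw [pow_succ _ 2]
    exact mul_dvd_mul_left _ (dvd_sub (dvd_pow_self _ (by omega)) ha)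
  · by_cases hu : b u = 0
    · rcases Nat.eq_zero_or_pos l with rfl | hl
      · rw [degenCount_eq_zero]
        exact dvd_zero _
      · exact cube_dvd_degenCount_of_parallel hl b h1 h2 (e := u) (f := v) huv.symm (c := 0)
          (by rw [hu, zero_smul])
    · rw [LinearIndependent.pair_iff' hu] at hind
      push Not at hind
      obtain ⟨c, hc⟩ := hind
      have hw : b w = (-(1 + c)) • b u := by
        rw [eq_neg_of_add_eq_zero_right h, ← hc]
        module
      rcases Nat.eq_zero_or_pos l with rfl | hl
      · rw [degenCount_eq_zero]
        exact dvd_zero _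
      refine (pow_dvd_degenCount_of_parallel b huv.symm huw.symm hvw.symm hc.symm hw).2 ?_
      rw [Fintype.card_fin]
      omega

/-- A family of more than `2 l` vectors in an `l`-dimensional space with a linear relation between at
most three of them with coefficients `± 1`: the number of degenerate forms is divisible by `q³`. -/
theorem cube_dvd_degenCount {σ : Type*} [Fintype σ] [DecidableEq σ] {l : ℕ}
    (b : σ → Fin l → F) (h1 : 2 * l < Fintype.card σ) (h2 : l = 0 ∨ 4 ≤ Fintype.card σ)
    (S : Finset σ) (hS : S.Nonempty) (hS3 : S.card ≤ 3) (s : σ → F) (hs : ∀ e ∈ S, s e * s e = 1)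
    (h : ∑ e ∈ S, s e • b e = 0) : Fintype.card F ^ 3 ∣ degenCount b := by
  rcases Nat.eq_zero_or_pos l with rfl | hl
  · rw [degenCount_eq_zero]
    exact dvd_zero _
  have h2 : 4 ≤ Fintype.card σ := by omega
  set t : σ → F := fun e => if e ∈ S then s e else 1 with ht
  have htS : ∀ e ∈ S, t e = s e := fun e he => if_pos he
  have htt : ∀ e, t e * t e = 1 := fun e => by
    by_cases he : e ∈ S
    · rw [htS e he, hs e he]
    · simp [ht, he]
  rw [← degenCount_smul b t htt]
  set b' : σ → Fin l → F := fun e => t e • b e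
  have h : ∑ e ∈ S, b' e = 0 := by
    rw [← h]
    exact Finset.sum_congr rfl fun e he => by rw [← htS e he]
  have hpos := hS.card_pos
  rcases (by omega : S.card = 1 ∨ S.card = 2 ∨ S.card = 3) with h3 | h3 | h3
  · obtain ⟨u, rfl⟩ := Finset.card_eq_one.1 h3
    rw [Finset.sum_singleton] at h
    obtain ⟨v, hv⟩ := Fintype.exists_ne_of_one_lt_card (by omega : 1 < Fintype.card σ) u
    exact cube_dvd_degenCount_of_parallel hl b' h1 h2 hv (c := 0) (by rw [h, zero_smul])
  · obtain ⟨u, v, huv, rfl⟩ := Finset.card_eq_two.1 h3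
    rw [Finset.sum_pair huv] at h
    exact cube_dvd_degenCount_of_parallel hl b' h1 h2 huv.symm (c := -1)
      (by rw [eq_neg_of_add_eq_zero_left h, neg_one_smul])
  · obtain ⟨u, v, w, huv, huw, hvw, rfl⟩ := Finset.card_eq_three.1 h3
    rw [Finset.sum_insert (by simp [huv, huw]), Finset.sum_pair hvw, ← add_assoc] at h
    exact cube_dvd_degenCount_of_add_eq_zero b' h1 h2 huv huw hvw h

end Divisibility

/-! ### Unimodular families and the Cauchy–Binet expansion -/

section CauchyBinet

variable {F σ ι : Type*} [Field F] [Fintype σ] [Fintype ι] [DecidableEq ι]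

theorem det_gram_eq_sum (v : σ → ι → F) (α : σ → F) :
    (gram v α).det = ∑ g : ι → σ, (∏ i, α (g i)) *
      ((∏ i, v (g i) i) * (Matrix.of fun i j => v (g i) j).det) := by
  classical
  have h1 : (gram v α).det = Matrix.detRowAlternating.toMultilinearMap
      (fun i => ∑ e : σ, (α e * v e i) • v e) := by
    change _ = Matrix.det _
    congr 1
    ext i j
    simp only [gram, Matrix.of_apply, Finset.sum_apply, Pi.smul_apply, smul_eq_mul]
    exact Finset.sum_congr rfl fun e _ => by ring
  rw [h1, MultilinearMap.map_sum]
  refine Finset.sum_congr rfl fun g _ => ?_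
  rw [MultilinearMap.map_smul_univ, Finset.prod_mul_distrib, smul_eq_mul, mul_assoc]
  rfl

/-- The **Cauchy–Binet formula** for a Gram matrix all of whose nonzero maximal minors have the same
square `c`. -/
theorem det_gram_eq_mul_sum [DecidableEq σ] (v : σ → ι → F) (c : F)
    (hc : ∀ g : ι → σ, (Matrix.of fun i j => v (g i) j).det ≠ 0 →
      (Matrix.of fun i j => v (g i) j).det ^ 2 = c)
    (𝓑 : Finset (Finset σ)) (h𝓑 : ∀ S, S ∈ 𝓑 ↔
      ∃ g : ι → σ, Finset.univ.image g = S ∧ (Matrix.of fun i j => v (g i) j).det ≠ 0)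
    (α : σ → F) :
    (gram v α).det = c * ∑ S ∈ 𝓑, ∏ e ∈ S, α e := by
  have hinj : ∀ g : ι → σ, (Matrix.of fun i j => v (g i) j).det ≠ 0 → Function.Injective g := by
    intro g hg i j hij
    by_contra hne
    exact hg (Matrix.det_zero_of_row_eq hne (by ext k; simp [hij]))
  rw [det_gram_eq_sum, ← Finset.sum_fiberwise (g := fun g : ι → σ => Finset.univ.image g),
    Finset.mul_sum, ← Finset.sum_subset (Finset.subset_univ 𝓑)]
  · refine Finset.sum_congr rfl fun S hS => ?_
    obtain ⟨g₀, hg₀, hdet⟩ := (h𝓑 S).1 hS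
    have hg₀inj := hinj g₀ hdet
    have hcard : S.card = Fintype.card ι := by
      rw [← hg₀, Finset.card_image_of_injective _ hg₀inj, Finset.card_univ]
    have hinj' : ∀ g : ι → σ, Finset.univ.image g = S → Function.Injective g := by
      intro g hg
      have := Finset.card_image_iff.1 (show (Finset.univ.image g).card = Finset.univ.card by
        rw [hg, hcard, Finset.card_univ])
      rwa [Finset.coe_univ, Set.injOn_univ] at this
    have hprod : ∀ g : ι → σ, Finset.univ.image g = S → ∏ i, α (g i) = ∏ e ∈ S, α e := by
      intro g hg
      have := hinj' g hg
      rw [← hg, Finset.prod_image fun x _ y _ h => this h]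
    -- the maps with image `S` are the compositions of `g₀` with a permutation
    have hsum : ∑ g : ι → σ with Finset.univ.image g = S, (∏ i, α (g i)) *
        ((∏ i, v (g i) i) * (Matrix.of fun i j => v (g i) j).det) =
        ∑ τ : Equiv.Perm ι, (∏ e ∈ S, α e) * ((∏ i, v (g₀ (τ i)) i) *
          (Matrix.of fun i j => v (g₀ (τ i)) j).det) := by
      symm
      refine Finset.sum_bij (fun τ _ => g₀ ∘ τ) ?_ ?_ ?_ ?_
      · intro τ _
        rw [Finset.mem_filter_univ, ← hg₀, ← Finset.image_image, Finset.image_univ_equiv]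
      · intro τ _ τ' _ h
        ext i
        exact hg₀inj (congrFun h i)
      · intro g hg
        rw [Finset.mem_filter_univ] at hg
        have h1 : ∀ i, ∃ k, g₀ k = g i := by
          intro i
          have : g i ∈ Finset.univ.image g₀ := by
            rw [hg₀, ← hg]
            exact Finset.mem_image_of_mem g (Finset.mem_univ i)
          simpa using this
        choose τ hτ using h1
        have hginj := hinj' g hg
        have hτinj : Function.Injective τ := fun i j hij => hginj (by rw [← hτ, ← hτ, hij])
        exact ⟨Equiv.ofBijective τ (Finite.injective_iff_bijective.1 hτinj), Finset.mem_univ _,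
          funext hτ⟩
      · intro τ _
        rw [← hprod (g₀ ∘ τ)]
        · rfl
        · rw [← hg₀, ← Finset.image_image, Finset.image_univ_equiv]
    rw [hsum, ← Finset.mul_sum, mul_comm c]
    congr 1
    rw [← hc g₀ hdet, sq]
    nth_rewrite 2 [Matrix.det_apply']
    rw [Finset.mul_sum]
    refine Finset.sum_congr rfl fun τ _ => ?_
    have : (Matrix.of fun i j => v (g₀ (τ i)) j) =
      (Matrix.of fun i j => v (g₀ i) j).submatrix τ id := rfl
    rw [this, Matrix.det_permute]
    simp only [Matrix.of_apply]
    ring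
  · intro S _ hS
    refine Finset.sum_eq_zero fun g hg => ?_
    rw [Finset.mem_filter_univ] at hg
    have : (Matrix.of fun i j => v (g i) j).det = 0 := by
      by_contra hne
      exact hS ((h𝓑 S).2 ⟨g, hg, hne⟩)
    rw [this, mul_zero, mul_zero]

end CauchyBinet

section Unimodular

variable {F σ ι V : Type*} [Field F] [Fintype ι] [DecidableEq ι] [AddCommGroup V] [Module F V]

theorem det_update_basis (β γ : Module.Basis ι F V) (i : ι) (w : V) :
    β.det (Function.update γ i w) = γ.repr w i * β.det γ := by
  conv_lhs => rw [← γ.sum_repr w]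
  rw [AlternatingMap.map_update_sum, Finset.sum_eq_single i]
  · rw [AlternatingMap.map_update_smul, Function.update_eq_self, smul_eq_mul]
  · intro k _ hk
    rw [AlternatingMap.map_update_smul, AlternatingMap.map_update_self _ _ hk.symm, smul_zero]
  · exact fun h => absurd (Finset.mem_univ i) h

theorem exists_basis_of_det_ne_zero (β : Module.Basis ι F V) (w : ι → V) (h : β.det w ≠ 0) :
    ∃ γ : Module.Basis ι F V, ⇑γ = w := by
  obtain ⟨h1, h2⟩ := (Module.Basis.is_basis_iff_det β).2 h.isUnit
  exact ⟨Module.Basis.mk h1 h2.ge, Module.Basis.coe_mk _ _⟩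

/-- If in each basis consisting of vectors of the family all coordinates of these vectors are `0` or
`± 1`, then all these bases have the same volume up to sign: they are connected by exchanges. -/
theorem det_sq_eq_of_unimodular (v : σ → V)
    (huni : ∀ (g : ι → σ) (γ : Module.Basis ι F V), (∀ i, γ i = v (g i)) →
      ∀ e i, γ.repr (v e) i ≠ 0 → γ.repr (v e) i ^ 2 = 1)
    (β : Module.Basis ι F V) (g' : ι → σ) (hg' : β.det (v ∘ g') ≠ 0) (g : ι → σ)
    (hg : β.det (v ∘ g) ≠ 0) : β.det (v ∘ g) ^ 2 = β.det (v ∘ g') ^ 2 := by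
  classical
  generalize hn : (Finset.univ.filter fun i => g i ∉ Set.range g').card = n
  induction n generalizing g with
  | zero =>
    rw [Finset.card_eq_zero, Finset.filter_eq_empty_iff] at hn
    have h1 : ∀ i, ∃ k, g' k = g i := fun i => by simpa using hn (Finset.mem_univ i)
    choose τ hτ using h1
    have hginj : Function.Injective g := by
      obtain ⟨γ, hγ⟩ := exists_basis_of_det_ne_zero β _ hg
      have := γ.injective
      rw [hγ] at this
      exact this.of_comp
    have hτinj : Function.Injective τ := fun i j hij => hginj (by rw [← hτ, ← hτ, hij])
    set τ' := Equiv.ofBijective τ (Finite.injective_iff_bijective.1 hτinj)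
    have h2 : v ∘ g = (v ∘ g') ∘ τ' := funext fun i => congrArg v (hτ i).symm
    rw [h2, AlternatingMap.map_perm]
    rcases Int.units_eq_one_or (Equiv.Perm.sign τ') with h | h <;> rw [h] <;> simp
  | succ n ih =>
    have h1 : (Finset.univ.filter fun i => g i ∉ Set.range g').Nonempty := by
      rw [← Finset.card_pos]
      omega
    obtain ⟨i, hi⟩ := h1
    rw [Finset.mem_filter_univ] at hi
    obtain ⟨γ, hγ⟩ := exists_basis_of_det_ne_zero β _ hg
    obtain ⟨γ', hγ'⟩ := exists_basis_of_det_ne_zero β _ hg'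
    obtain ⟨j, hj⟩ : ∃ j, γ.repr (v (g' j)) i ≠ 0 := by
      by_contra hcon
      push Not at hcon
      have h2 : γ.coord i = 0 := γ'.ext fun j => by
        rw [hγ']
        simpa using hcon j
      have h3 := congrArg (fun φ => φ (γ i)) h2
      simp at h3
    have hup : v ∘ Function.update g i (g' j) = Function.update γ i (v (g' j)) := by
      rw [Function.comp_update, hγ]
    have hdet : β.det (v ∘ Function.update g i (g' j)) =
        γ.repr (v (g' j)) i * β.det (v ∘ g) := by
      rw [hup, det_update_basis, hγ]
    have h4 := ih (Function.update g i (g' j)) (by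
      rw [hdet]
      exact mul_ne_zero hj hg) (by
      have h5 : (Finset.univ.filter fun k => Function.update g i (g' j) k ∉ Set.range g') =
          (Finset.univ.filter fun k => g k ∉ Set.range g').erase i := by
        ext k
        rw [Finset.mem_erase, Finset.mem_filter_univ, Finset.mem_filter_univ]
        by_cases hk : k = i
        · subst hk
          simp
        · simp [hk]
      rw [h5, Finset.card_erase_of_mem (by rwa [Finset.mem_filter_univ]), hn]
      rfl)
    rw [← h4, hdet, mul_pow, huni g γ (fun i => by rw [hγ]; rfl) _ _ hj, one_mul]

end Unimodular

/-! ### Spanning trees and potentials -/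

section Trees

variable {W σ : Type*}

/-- Two vertices are joined by a path with edges in `T`, in a multigraph whose edge `e` has the end
points `s e` and `t e`. -/
def Reach (s t : σ → W) (T : Set σ) : W → W → Prop :=
  Relation.ReflTransGen fun x y => ∃ e ∈ T, (s e = x ∧ t e = y) ∨ (s e = y ∧ t e = x)

/-- `T` is the edge set of a spanning tree. -/
def IsTree [Fintype W] (s t : σ → W) (T : Finset σ) : Prop :=
  (∀ u v, Reach s t T u v) ∧ T.card + 1 = Fintype.card W

variable (F : Type*) [Field F]

/-- The coboundary `(δ p)_e = p (t e) - p (s e)` of a potential `p`. -/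
def coboundary (s t : σ → W) : (W → F) →ₗ[F] (σ → F) where
  toFun p e := p (t e) - p (s e)
  map_add' p p' := by
    ext e
    simp only [Pi.add_apply]
    ring
  map_smul' c p := by
    ext e
    simp only [Pi.smul_apply, smul_eq_mul, RingHom.id_apply]
    ring

variable {F}

theorem coboundary_apply (s t : σ → W) (p : W → F) (e : σ) :
    coboundary F s t p e = p (t e) - p (s e) := rfl

theorem Reach.eq_of_coboundary {s t : σ → W} {T : Set σ} {p : W → F}
    (hp : ∀ e ∈ T, coboundary F s t p e = 0) {u v : W} (h : Reach s t T u v) : p u = p v := by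
  induction h with
  | refl => rfl
  | tail _ hstep ih =>
    obtain ⟨e, he, h⟩ := hstep
    have h1 := hp e he
    rw [coboundary_apply, sub_eq_zero] at h1
    rcases h with ⟨rfl, rfl⟩ | ⟨rfl, rfl⟩
    · rw [ih, h1]
    · rw [ih, h1]

theorem finrank_range_coboundary [Fintype W] [Nonempty W] [Fintype σ] (s t : σ → W)
    (hconn : ∀ u v, Reach s t Set.univ u v) :
    Module.finrank F (LinearMap.range (coboundary F s t)) + 1 = Fintype.card W := by
  have hker : LinearMap.ker (coboundary F s t) = Submodule.span F {fun _ => (1 : F)} := by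
    ext p
    rw [LinearMap.mem_ker, Submodule.mem_span_singleton]
    constructor
    · intro h
      obtain ⟨w⟩ := ‹Nonempty W›
      refine ⟨p w, funext fun u => ?_⟩
      rw [Pi.smul_apply, smul_eq_mul, mul_one]
      exact (hconn w u).eq_of_coboundary fun e _ => congrFun h e
    · rintro ⟨c, rfl⟩
      ext e
      simp [coboundary_apply]
  have h1 := LinearMap.finrank_range_add_finrank_ker (coboundary F s t)
  rw [hker, finrank_span_singleton (by
    intro h
    obtain ⟨w⟩ := ‹Nonempty W›
    exact one_ne_zero (congrFun h w)), Module.finrank_fintype_fun_eq_card] at h1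
  exact h1

variable (F)

/-- The space of coordinates on the cycle space: functions on the edges modulo coboundaries. -/
abbrev CycleDual (s t : σ → W) : Type _ := (σ → F) ⧸ LinearMap.range (coboundary F s t)

variable {F}

theorem finrank_cycleDual [Fintype W] [Nonempty W] [Fintype σ] (s t : σ → W)
    (hconn : ∀ u v, Reach s t Set.univ u v) :
    Module.finrank F (CycleDual F s t) + Fintype.card W = Fintype.card σ + 1 := by
  have h1 := finrank_range_coboundary (F := F) s t hconn
  have h2 : Module.finrank F (CycleDual F s t) +
      Module.finrank F (LinearMap.range (coboundary F s t)) = Module.finrank F (σ → F) :=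
    Submodule.finrank_quotient_add_finrank (LinearMap.range (coboundary F s t))
  rw [Module.finrank_fintype_fun_eq_card] at h2
  omega

variable [DecidableEq σ]

/-- The coordinate of the edge `e` on the cycle space. -/
def edgeVec (F : Type*) [Field F] (s t : σ → W) (e : σ) : CycleDual F s t :=
  Submodule.Quotient.mk (Pi.single e 1)

theorem mk_eq_sum_edgeVec [Fintype σ] (s t : σ → W) (x : σ → F) :
    (Submodule.Quotient.mk x : CycleDual F s t) = ∑ e, x e • edgeVec F s t e := by
  have h : x = ∑ e, x e • (Pi.single e 1 : σ → F) := by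
    ext e'
    simp [Pi.single_apply]
  conv_lhs => rw [h]
  rw [← Submodule.mkQ_apply, map_sum]
  simp only [map_smul]
  rfl

theorem sum_coboundary_smul_edgeVec [Fintype σ] (s t : σ → W) (p : W → F) :
    ∑ e, coboundary F s t p e • edgeVec F s t e = 0 := by
  rw [← mk_eq_sum_edgeVec, Submodule.Quotient.mk_eq_zero]
  exact LinearMap.mem_range_self _ p

section Basis

variable [Fintype σ] {ι : Type*} [Fintype ι]

/-- The complement of a basis of edges connects all vertices: otherwise the indicator function of a
component is a potential whose coboundary is a linear relation. -/
theorem reach_compl_of_linearIndependent {s t : σ → W} (hconn : ∀ u v, Reach s t Set.univ u v)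
    {g : ι → σ} (hg : LinearIndependent F (fun i => edgeVec F s t (g i))) (u v : W) :
    Reach s t (Set.range g)ᶜ u v := by
  classical
  have hginj : Function.Injective g := hg.injective.of_comp (f := edgeVec F s t)
  set p : W → F := fun w => if Reach s t (Set.range g)ᶜ u w then 1 else 0 with hp
  have h1 : ∀ e ∈ (Set.range g)ᶜ, coboundary F s t p e = 0 := by
    intro e he
    have h2 : Reach s t (Set.range g)ᶜ u (t e) ↔ Reach s t (Set.range g)ᶜ u (s e) :=
      ⟨fun h => h.tail ⟨e, he, Or.inr ⟨rfl, rfl⟩⟩, fun h => h.tail ⟨e, he, Or.inl ⟨rfl, rfl⟩⟩⟩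
    rw [coboundary_apply, hp]
    simp only [h2, sub_self]
  have h3 := sum_coboundary_smul_edgeVec s t p
  rw [← Finset.sum_subset (Finset.subset_univ (Finset.univ.image g)) (fun e _ he => by
      rw [h1 e (by simpa using he), zero_smul]),
    Finset.sum_image fun x _ y _ h => hginj h] at h3
  have h4 := Fintype.linearIndependent_iff.1 hg _ h3
  have h5 : p u = p v := (hconn u v).eq_of_coboundary fun e _ => by
    by_cases he : e ∈ Set.range g
    · obtain ⟨i, rfl⟩ := he
      exact h4 i
    · exact h1 e he
  by_contra hcon
  rw [hp] at h5
  simp only [hcon, if_false] at h5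
  rw [if_pos (show Reach s t (Set.range g)ᶜ u u from Relation.ReflTransGen.refl)] at h5
  exact one_ne_zero h5

/-- Fundamental cuts: with respect to a basis of edges all edges have coordinates `0` or `± 1`,
because a potential which is constant along all but one edge of a spanning tree has two values. -/
theorem edgeVec_unimodular {s t : σ → W} (hconn : ∀ u v, Reach s t Set.univ u v) (g : ι → σ)
    (γ : Module.Basis ι F (CycleDual F s t)) (hγ : ∀ i, γ i = edgeVec F s t (g i)) (e : σ) (i : ι)
    (h : γ.repr (edgeVec F s t e) i ≠ 0) : γ.repr (edgeVec F s t e) i ^ 2 = 1 := by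
  classical
  have hli : LinearIndependent F (fun i => edgeVec F s t (g i)) := by
    have := γ.linearIndependent
    rwa [funext hγ] at this
  have hginj : Function.Injective g := hli.injective.of_comp (f := edgeVec F s t)
  by_cases he : e ∈ Set.range g
  · obtain ⟨k, rfl⟩ := he
    rw [← hγ, Module.Basis.repr_self] at h ⊢
    by_cases hk : k = i
    · subst hk
      simp
    · rw [Finsupp.single_eq_of_ne (Ne.symm hk)] at h
      exact absurd rfl h
  set c := γ.repr (edgeVec F s t e) with hc
  have h1 : (Submodule.Quotient.mk (Pi.single e 1 - ∑ k, c k • (Pi.single (g k) 1 : σ → F)) :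
      CycleDual F s t) = 0 := by
    rw [← Submodule.mkQ_apply, map_sub, map_sum, sub_eq_zero]
    simp only [map_smul]
    have h2 := γ.sum_repr (edgeVec F s t e)
    simp only [hγ] at h2
    exact h2.symm
  rw [Submodule.Quotient.mk_eq_zero] at h1
  obtain ⟨p, hp⟩ := h1
  have hpe : p (t e) - p (s e) = 1 := by
    have := congrFun hp e
    rw [coboundary_apply] at this
    rw [this]
    have h2 : ∀ k, e ≠ g k := fun k hk => he ⟨k, hk.symm⟩
    simp [Finset.sum_apply, h2]
  have hpi : p (t (g i)) - p (s (g i)) = -c i := by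
    have := congrFun hp (g i)
    rw [coboundary_apply] at this
    rw [this]
    have h2 : g i ≠ e := fun hk => he ⟨i, hk⟩
    simp [Finset.sum_apply, h2, Pi.single_apply, hginj.eq_iff]
  have hpT : ∀ e', e' ∉ Set.range g → e' ≠ e → p (t e') = p (s e') := by
    intro e' he' hne
    have := congrFun hp e'
    rw [coboundary_apply] at this
    rw [← sub_eq_zero, this]
    have h2 : ∀ k, e' ≠ g k := fun k hk => he' ⟨k, hk.symm⟩
    simp [Finset.sum_apply, h2, hne]
  have hval : ∀ u, p u = p (s e) ∨ p u = p (t e) := by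
    intro u
    have hr := reach_compl_of_linearIndependent hconn hli (s e) u
    induction hr with
    | refl => exact Or.inl rfl
    | tail _ hstep ih =>
      obtain ⟨e', he', hlink⟩ := hstep
      by_cases hee : e' = e
      · subst hee
        rcases hlink with ⟨rfl, rfl⟩ | ⟨rfl, rfl⟩
        · exact Or.inr rfl
        · exact Or.inl rfl
      · have h2 := hpT e' he' hee
        rcases hlink with ⟨rfl, rfl⟩ | ⟨rfl, rfl⟩
        · rwa [h2]
        · rwa [← h2]
  have hci : c i = p (s (g i)) - p (t (g i)) := by rw [← neg_sub, hpi, neg_neg]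
  rw [hci] at h ⊢
  rw [sub_eq_iff_eq_add] at hpe
  rcases hval (s (g i)) with h2 | h2 <;> rcases hval (t (g i)) with h3 | h3 <;>
    rw [h2, h3] at h ⊢
  · simp at h
  · rw [hpe]
    ring
  · rw [hpe]
    ring
  · simp at h

theorem linearIndependent_of_isTree [Fintype W] {s t : σ → W} {g : ι → σ} (hginj : Function.Injective g)
    (hT : IsTree s t (Finset.univ.image g)ᶜ) :
    LinearIndependent F (fun i => edgeVec F s t (g i)) := by
  classical
  rw [Fintype.linearIndependent_iff]
  intro c hc i
  have h1 : (Submodule.Quotient.mk (∑ k, c k • (Pi.single (g k) 1 : σ → F)) :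
      CycleDual F s t) = 0 := by
    rw [← Submodule.mkQ_apply, map_sum]
    simp only [map_smul]
    exact hc
  rw [Submodule.Quotient.mk_eq_zero] at h1
  obtain ⟨p, hp⟩ := h1
  have hpT : ∀ e ∈ (((Finset.univ.image g)ᶜ : Finset σ) : Set σ), coboundary F s t p e = 0 := by
    intro e he
    rw [hp]
    have h2 : ∀ k, e ≠ g k := by
      intro k hk
      rw [hk] at he
      simp at he
    simp [Finset.sum_apply, h2]
  have h3 : coboundary F s t p (g i) = c i := by
    rw [hp]
    simp [Finset.sum_apply, Pi.single_apply, hginj.eq_iff]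
  rw [← h3, coboundary_apply, (hT.1 (t (g i)) (s (g i))).eq_of_coboundary hpT, sub_self]

end Basis

variable [Fintype W] [Fintype σ]

open scoped Classical in
/-- The value at `α` of the graph polynomial `∑_T ∏_{e ∉ T} α_e`. -/
noncomputable def treeSum (s t : σ → W) (α : σ → F) : F :=
  ∑ T ∈ Finset.univ.filter (fun T : Finset σ => IsTree s t T), ∏ e ∈ Tᶜ, α e

/-- The graph polynomial of a connected graph is the discriminant of the quadratic form
`∑_e α_e x_e²` on the cycle space. -/
theorem exists_det_gram_eq_mul_treeSum [Nonempty W] {s t : σ → W}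
    (hconn : ∀ u v, Reach s t Set.univ u v) {ι : Type*} [Fintype ι] [DecidableEq ι]
    (β : Module.Basis ι F (CycleDual F s t)) :
    ∃ c : F, c ≠ 0 ∧ ∀ α : σ → F,
      (gram (fun e i => β.repr (edgeVec F s t e) i) α).det = c * treeSum s t α := by
  classical
  have hdet : ∀ g : ι → σ, (Matrix.of fun i j => β.repr (edgeVec F s t (g i)) j).det =
      β.det (edgeVec F s t ∘ g) := by
    intro g
    rw [Module.Basis.det_apply, ← Matrix.det_transpose]
    rfl
  have hrank := finrank_cycleDual (F := F) s t hconn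
  rw [Module.finrank_eq_card_basis β] at hrank
  obtain ⟨c, hc0, hc⟩ : ∃ c : F, c ≠ 0 ∧ ∀ g : ι → σ, β.det (edgeVec F s t ∘ g) ≠ 0 →
      β.det (edgeVec F s t ∘ g) ^ 2 = c := by
    by_cases hex : ∃ g : ι → σ, β.det (edgeVec F s t ∘ g) ≠ 0
    · obtain ⟨g', hg'⟩ := hex
      exact ⟨_, pow_ne_zero 2 hg', fun g hg => det_sq_eq_of_unimodular (edgeVec F s t)
        (fun g γ hγ e i => edgeVec_unimodular hconn g γ hγ e i) β g' hg' g hg⟩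
    · push Not at hex
      exact ⟨1, one_ne_zero, fun g hg => absurd (hex g) hg⟩
  refine ⟨c, hc0, fun α => ?_⟩
  rw [det_gram_eq_mul_sum (fun e i => β.repr (edgeVec F s t e) i) c
    (fun g hg => by rw [hdet] at hg ⊢; exact hc g hg)
    ((Finset.univ.filter fun T : Finset σ => IsTree s t T).image Compl.compl) ?_ α, treeSum,
    Finset.sum_image fun x _ y _ h => compl_injective h]
  intro S
  have hmem : S ∈ (Finset.univ.filter fun T : Finset σ => IsTree s t T).image Compl.compl ↔
      IsTree s t Sᶜ := by
    rw [Finset.mem_image]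
    constructor
    · rintro ⟨T, hT, rfl⟩
      rw [compl_compl]
      exact (Finset.mem_filter_univ _).1 hT
    · intro h
      exact ⟨Sᶜ, (Finset.mem_filter_univ _).2 h, compl_compl S⟩
  rw [hmem]
  constructor
  · intro hT
    have hcard : Fintype.card ι = Fintype.card S := by
      have h1 := hT.2
      rw [Finset.card_compl] at h1
      have h2 := Finset.card_le_univ S
      rw [Fintype.card_coe]
      omega
    set ε := Fintype.equivOfCardEq hcard
    have himage : Finset.univ.image (fun i => (ε i : σ)) = S := by
      ext e
      simp only [Finset.mem_image, Finset.mem_univ, true_and]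
      exact ⟨fun ⟨i, hi⟩ => hi ▸ (ε i).2, fun he => ⟨ε.symm ⟨e, he⟩, by simp⟩⟩
    refine ⟨fun i => ε i, himage, ?_⟩
    rw [hdet]
    have hli : LinearIndependent F (edgeVec F s t ∘ fun i => (ε i : σ)) :=
      linearIndependent_of_isTree (fun i j h => ε.injective (Subtype.ext h)) (by rwa [himage])
    exact ((Module.Basis.is_basis_iff_det β).1 ⟨hli, hli.span_eq_top_of_card_eq_finrank'
      (Module.finrank_eq_card_basis β).symm⟩).ne_zero
  · rintro ⟨g, rfl, hg⟩
    rw [hdet] at hg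
    obtain ⟨hli, -⟩ := (Module.Basis.is_basis_iff_det β).2 hg.isUnit
    have hginj : Function.Injective g := hli.injective.of_comp (f := edgeVec F s t)
    refine ⟨fun u v => ?_, ?_⟩
    · have := reach_compl_of_linearIndependent hconn hli u v
      simpa using this
    · have := Fintype.card_le_of_injective g hginj
      rw [Finset.card_compl, Finset.card_image_of_injective _ hginj, Finset.card_univ]
      omega

end Trees

/-! ### Point counts of graph polynomials -/

section Counts

variable {W σ F : Type*} [Field F]

theorem Reach.mono {s t : σ → W} {T T' : Set σ} (h : T ⊆ T') {u v : W} (hr : Reach s t T u v) :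
    Reach s t T' u v :=
  Relation.ReflTransGen.mono (fun _ _ ⟨e, he, hl⟩ => ⟨e, h he, hl⟩) _ _ hr

variable [Fintype σ]

/-- The non-loop edges at a vertex. -/
def star [DecidableEq W] (s t : σ → W) (w : W) : Finset σ :=
  Finset.univ.filter fun e => s e ≠ t e ∧ (s e = w ∨ t e = w)

theorem coboundary_single_mul_self [DecidableEq W] (s t : σ → W) (w : W) {e : σ}
    (he : e ∈ star s t w) :
    coboundary F s t (Pi.single w 1) e * coboundary F s t (Pi.single w 1) e = 1 := by
  rw [star, Finset.mem_filter_univ] at he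
  rw [coboundary_apply]
  obtain ⟨hne, rfl | rfl⟩ := he
  · rw [Pi.single_eq_same, Pi.single_eq_of_ne hne.symm]
    ring
  · rw [Pi.single_eq_same, Pi.single_eq_of_ne hne]
    ring

/-- The coordinates of the edges at a vertex satisfy a linear relation, the coboundary of the
indicator function of the vertex. -/
theorem sum_star_smul_edgeVec [DecidableEq W] [DecidableEq σ] (s t : σ → W) (w : W) :
    ∑ e ∈ star s t w, coboundary F s t (Pi.single w 1) e • edgeVec F s t e = 0 := by
  rw [← sum_coboundary_smul_edgeVec s t (Pi.single w (1 : F))]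
  refine Finset.sum_subset (Finset.subset_univ _) fun e _ he => ?_
  rw [star, Finset.mem_filter_univ, not_and_or, not_or, not_not] at he
  rw [coboundary_apply]
  rcases he with h | ⟨h1, h2⟩
  · rw [h, sub_self, zero_smul]
  · rw [Pi.single_eq_of_ne h1, Pi.single_eq_of_ne h2, sub_self, zero_smul]

variable [Fintype W]

theorem exists_card_star_le [DecidableEq W] (s t : σ → W)
    (h : Fintype.card σ < 2 * Fintype.card W) : ∃ w, (star s t w).card ≤ 3 := by
  by_contra hcon
  push Not at hcon
  have h1 : ∑ w : W, (star s t w).card ≤ ∑ _e : σ, 2 := by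
    simp only [star, Finset.card_filter]
    rw [Finset.sum_comm]
    refine Finset.sum_le_sum fun e _ => ?_
    rw [← Finset.card_filter]
    refine (Finset.card_le_card (t := {s e, t e}) fun w hw => ?_).trans Finset.card_le_two
    rw [Finset.mem_filter_univ] at hw
    rw [Finset.mem_insert, Finset.mem_singleton]
    exact hw.2.imp Eq.symm Eq.symm
  have h2 : ∑ _w : W, 4 ≤ ∑ w : W, (star s t w).card := Finset.sum_le_sum fun w _ => hcon w
  simp only [Finset.sum_const, Finset.card_univ, smul_eq_mul] at h1 h2
  omega

theorem star_nonempty [DecidableEq W] {s t : σ → W} (hconn : ∀ u v, Reach s t Set.univ u v)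
    (h : 1 < Fintype.card W) (w : W) : (star s t w).Nonempty := by
  by_contra hcon
  rw [Finset.not_nonempty_iff_eq_empty, star, Finset.filter_eq_empty_iff] at hcon
  obtain ⟨v, hv⟩ := Fintype.exists_ne_of_one_lt_card h w
  have key : ∀ v, Reach s t Set.univ w v → v = w := by
    intro v hr
    induction hr with
    | refl => rfl
    | tail _ hstep ih =>
      subst ih
      obtain ⟨e, -, he⟩ := hstep
      have h1 := hcon (Finset.mem_univ e)
      by_contra hne
      rcases he with ⟨h2, h3⟩ | ⟨h2, h3⟩
      · exact h1 ⟨by rw [h2, h3]; exact Ne.symm hne, Or.inl h2⟩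
      · exact h1 ⟨by rw [h2, h3]; exact hne, Or.inr h3⟩
  exact hv (key v (hconn w v))

variable [DecidableEq σ]

theorem treeSum_eq_zero_of_not_connected {s t : σ → W} (h : ¬ ∀ u v, Reach s t Set.univ u v)
    (α : σ → F) : treeSum s t α = 0 := by
  classical
  rw [treeSum, Finset.filter_eq_empty_iff.2, Finset.sum_empty]
  intro T _ hT
  exact h fun u v => (hT.1 u v).mono (Set.subset_univ _)

/-- For a connected graph the zeros of the graph polynomial are the parameters of degenerate
quadratic forms on the cycle space. -/
theorem exists_degenCount_eq_card_treeSum [Nonempty W] {s t : σ → W}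
    (hconn : ∀ u v, Reach s t Set.univ u v) :
    ∃ (l : ℕ) (β : Module.Basis (Fin l) F (CycleDual F s t)),
      l + Fintype.card W = Fintype.card σ + 1 ∧
      Nat.card {α : σ → F // treeSum s t α = 0} =
        degenCount fun e i => β.repr (edgeVec F s t e) i := by
  set β := Module.finBasis F (CycleDual F s t)
  refine ⟨_, β, finrank_cycleDual s t hconn, ?_⟩
  obtain ⟨c, hc, h⟩ := exists_det_gram_eq_mul_treeSum hconn β
  refine Nat.card_congr (Equiv.subtypeEquivRight fun α => ?_)
  rw [h, mul_eq_zero, or_iff_right hc]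

variable [Fintype F]

theorem card_treeSum_eq_zero_of_not_connected {s t : σ → W}
    (h : ¬ ∀ u v, Reach s t Set.univ u v) :
    Nat.card {α : σ → F // treeSum s t α = 0} = Fintype.card F ^ Fintype.card σ := by
  simp [treeSum_eq_zero_of_not_connected h]

/-- For a graph with at most twice as many edges as a spanning tree, `q²` divides the number of
zeros of the graph polynomial. -/
theorem sq_dvd_card_treeSum (s t : σ → W) (h1 : 4 ≤ Fintype.card W)
    (h2 : Fintype.card W ≤ Fintype.card σ + 1) (h3 : Fintype.card σ + 2 ≤ 2 * Fintype.card W) :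
    Fintype.card F ^ 2 ∣ Nat.card {α : σ → F // treeSum s t α = 0} := by
  by_cases hconn : ∀ u v, Reach s t Set.univ u v
  · have : Nonempty W := Fintype.card_pos_iff.1 (by omega)
    obtain ⟨l, β, hl, h⟩ := exists_degenCount_eq_card_treeSum (F := F) hconn
    rw [h]
    exact sq_dvd_degenCount l _ (by omega) (by omega)
  · rw [card_treeSum_eq_zero_of_not_connected hconn]
    exact pow_dvd_pow _ (by omega)

/-- For a graph with fewer than twice as many edges as a spanning tree, `q³` divides the number of
zeros of the graph polynomial.  Such a graph has a vertex of valency at most three. -/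
theorem cube_dvd_card_treeSum (s t : σ → W) (h1 : 4 ≤ Fintype.card W)
    (h2 : Fintype.card W ≤ Fintype.card σ + 1) (h3 : Fintype.card σ + 2 < 2 * Fintype.card W) :
    Fintype.card F ^ 3 ∣ Nat.card {α : σ → F // treeSum s t α = 0} := by
  classical
  by_cases hconn : ∀ u v, Reach s t Set.univ u v
  · have : Nonempty W := Fintype.card_pos_iff.1 (by omega)
    obtain ⟨l, β, hl, h⟩ := exists_degenCount_eq_card_treeSum (F := F) hconn
    obtain ⟨w, hw⟩ := exists_card_star_le s t (by omega)
    rw [h]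
    refine cube_dvd_degenCount _ (by omega) (by omega) (star s t w)
      (star_nonempty hconn (by omega) w) hw (coboundary F s t (Pi.single w 1))
      (fun e he => coboundary_single_mul_self s t w he) ?_
    ext i
    have h4 := congrArg (fun x => β.repr x i) (sum_star_smul_edgeVec (F := F) s t w)
    simp only [map_sum, map_smul, map_zero, Finsupp.coe_finsetSum, Finset.sum_apply,
      Finsupp.smul_apply, Finsupp.coe_zero, Pi.zero_apply] at h4
    simpa only [Finset.sum_apply, Pi.smul_apply, Pi.zero_apply] using h4
  · rw [card_treeSum_eq_zero_of_not_connected hconn]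
    exact pow_dvd_pow _ (by omega)

end Counts

/-! ### Hypersurfaces in products of projective lines -/

section Projective

variable {F : Type*} [Field F]

/-- The first homogeneous coordinate of a point of the projective line `F ∪ {∞}`, where `∞` is
`none`. -/
def projNum : Option F → F
  | none => 1
  | some a => a

/-- The second homogeneous coordinate of a point of the projective line `F ∪ {∞}`. -/
def projDen : Option F → F
  | none => 0
  | some _ => 1

open scoped Classical in
/-- The inversion `x ↦ 1 / x` of the projective line. -/
noncomputable def projInv : Option F → Option F
  | none => some 0
  | some a => if a = 0 then none else some a⁻¹

theorem projInv_involutive : Function.Involutive (projInv (F := F)) := by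
  classical
  intro x
  cases x with
  | none => simp [projInv]
  | some a =>
    by_cases h : a = 0
    · simp [projInv, h]
    · simp [projInv, h]

theorem exists_projInv_eq (x : Option F) :
    ∃ u : F, u ≠ 0 ∧ projNum (projInv x) = u * projDen x ∧ projDen (projInv x) = u * projNum x := by
  classical
  cases x with
  | none => exact ⟨1, one_ne_zero, by simp [projInv, projNum, projDen]⟩
  | some a =>
    by_cases h : a = 0
    · exact ⟨1, one_ne_zero, by simp [projInv, projNum, projDen, h]⟩
    · exact ⟨a⁻¹, inv_ne_zero h, by simp [projInv, projNum, projDen, h]⟩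

variable {E : Type*} [Fintype E] [DecidableEq E]

/-- The multihomogeneous form `∑_S ∏_{e ∈ S} x_e ∏_{e ∉ S} y_e` on a product of projective lines. -/
def multiForm (𝓕 : Finset (Finset E)) (p : E → Option F) : F :=
  ∑ S ∈ 𝓕, (∏ e ∈ S, projNum (p e)) * ∏ e ∈ Sᶜ, projDen (p e)

/-- The number of zeros of `∑_S ∏_{e ∈ S} x_e ∏_{e ∉ S} y_e` in a product of projective lines. -/
noncomputable def projCount (F : Type*) [Field F] (𝓕 : Finset (Finset E)) : ℕ :=
  Nat.card {p : E → Option F // multiForm 𝓕 p = 0}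

/-- The number of zeros of the coefficient of `∏_{e ∈ J} x_e` in `∑_S ∏_{e ∈ S} x_e`, as a
polynomial in the remaining variables. -/
noncomputable def coeffCount (F : Type*) [Field F] (𝓕 : Finset (Finset E)) (J : Finset E) : ℕ :=
  Nat.card {a : {e // e ∉ J} → F //
    ∑ S ∈ 𝓕.filter (J ⊆ ·), ∏ e ∈ Finset.univ.filter (fun e : {e // e ∉ J} => (e : E) ∈ S), a e = 0}

/-- The Cremona transformation exchanges a family of sets with the family of the complements. -/
theorem projCount_image_compl (𝓕 : Finset (Finset E)) :
    projCount F (𝓕.image Compl.compl) = projCount F 𝓕 := by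
  refine Nat.card_congr (((Equiv.refl E).arrowCongr
    projInv_involutive.toPerm).subtypeEquiv fun p => ?_)
  have h : (Equiv.refl E).arrowCongr projInv_involutive.toPerm p = fun e => projInv (p e) := rfl
  rw [h]
  choose u hu0 hu1 hu2 using fun e => exists_projInv_eq (p e)
  have h1 : multiForm 𝓕 (fun e => projInv (p e)) =
      (∏ e, u e) * multiForm (𝓕.image Compl.compl) p := by
    rw [multiForm, multiForm, Finset.sum_image fun x _ y _ h => compl_injective h, Finset.mul_sum]
    refine Finset.sum_congr rfl fun S _ => ?_
    simp only [hu1, hu2, Finset.prod_mul_distrib, compl_compl]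
    rw [← Finset.prod_mul_prod_compl S u]
    ring
  rw [h1, mul_eq_zero, or_iff_right (Finset.prod_ne_zero_iff.2 fun e _ => hu0 e)]

theorem prod_subtype_filter (J S : Finset E) (f : E → F) :
    ∏ e ∈ Finset.univ.filter (fun e : {e // e ∉ J} => (e : E) ∈ S), f e = ∏ e ∈ S \ J, f e := by
  refine Finset.prod_bij (fun e _ => (e : E)) ?_ ?_ ?_ ?_
  · intro e he
    exact Finset.mem_sdiff.2 ⟨(Finset.mem_filter.1 he).2, e.2⟩
  · intro a _ b _ h
    exact Subtype.ext h
  · intro e he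
    rw [Finset.mem_sdiff] at he
    exact ⟨⟨e, he.2⟩, (Finset.mem_filter_univ _).2 he.1, rfl⟩
  · intro _ _
    rfl

/-- The points at infinity are sorted by the set of their infinite coordinates. -/
theorem projCount_eq_sum [Fintype F] (𝓕 : Finset (Finset E)) :
    projCount F 𝓕 = ∑ J : Finset E, coeffCount F 𝓕 J := by
  classical
  have h1 : projCount F 𝓕 = ∑ J : Finset E, Nat.card {p : E → Option F //
      multiForm 𝓕 p = 0 ∧ (Finset.univ.filter fun e => p e = none) = J} := by
    simp only [projCount, Nat.card_eq_fintype_card, Fintype.card_subtype]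
    rw [Finset.card_eq_sum_card_fiberwise (t := Finset.univ)
      (f := fun p : E → Option F => Finset.univ.filter fun e => p e = none)
      fun _ _ => Finset.mem_coe.2 (Finset.mem_univ _)]
    refine Finset.sum_congr rfl fun J _ => ?_
    rw [Finset.filter_filter]
  rw [h1]
  refine Finset.sum_congr rfl fun J _ => ?_
  let ext : ({e // e ∉ J} → F) → E → Option F := fun a e => if h : e ∈ J then none else some (a ⟨e, h⟩)
  have hnone : ∀ a, (Finset.univ.filter fun e => ext a e = none) = J := by
    intro a
    ext e
    rw [Finset.mem_filter_univ]
    by_cases h : e ∈ J <;> simp [ext, h]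
  have hform : ∀ a, multiForm 𝓕 (ext a) = ∑ S ∈ 𝓕.filter (J ⊆ ·),
      ∏ e ∈ Finset.univ.filter (fun e : {e // e ∉ J} => (e : E) ∈ S), a e := by
    intro a
    rw [multiForm, Finset.sum_filter]
    refine Finset.sum_congr rfl fun S _ => ?_
    split_ifs with hJ
    · have h2 : ∏ e ∈ Sᶜ, projDen (ext a e) = 1 := Finset.prod_eq_one fun e he => by
        have : e ∉ J := fun h => Finset.mem_compl.1 he (hJ h)
        simp [ext, this, projDen]
      have h3 : ∏ e ∈ Finset.univ.filter (fun e : {e // e ∉ J} => (e : E) ∈ S), a e =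
          ∏ e ∈ Finset.univ.filter (fun e : {e // e ∉ J} => (e : E) ∈ S),
            projNum (ext a e) := Finset.prod_congr rfl fun e _ => by simp [ext, e.2, projNum]
      rw [h2, mul_one, h3, prod_subtype_filter J S fun e => projNum (ext a e),
        ← Finset.prod_sdiff hJ, Finset.prod_eq_one (s := J) fun e he => by
          simp [ext, he, projNum], mul_one]
    · obtain ⟨e, heJ, heS⟩ := Finset.not_subset.1 hJ
      rw [Finset.prod_eq_zero (Finset.mem_compl.2 heS) (by simp [ext, heJ, projDen]), mul_zero]
  have hext : ∀ p : E → Option F, (Finset.univ.filter fun e => p e = none) = J →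
      ext (fun e => (p e).getD 0) = p := by
    intro p hp
    funext e
    have h2 : e ∈ J ↔ p e = none := by rw [← hp, Finset.mem_filter_univ]
    by_cases h : e ∈ J
    · simp [ext, h, h2.1 h]
    · obtain ⟨x, hx⟩ := Option.ne_none_iff_exists'.1 fun h' => h (h2.2 h')
      simp [ext, h, hx]
  refine Nat.card_congr
    { toFun := fun p => ⟨fun e => (p.1 e).getD 0, by rw [← hform, hext p.1 p.2.2, p.2.1]⟩
      invFun := fun a => ⟨ext a.1, (hform a.1).trans a.2, hnone a.1⟩
      left_inv := fun p => Subtype.ext (hext p.1 p.2.2)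
      right_inv := fun a => Subtype.ext (funext fun e => by simp [ext, e.2]) }

/-- A point count in a product of projective lines, modulo `q³`, when the contributions of the
points at infinity of low codimension are trivial. -/
theorem projCount_modEq [Fintype F] {n : ℕ} (𝓕 : Finset (Finset E)) (hn : ∀ S ∈ 𝓕, S.card = n)
    (h : ∀ J : Finset E, J.Nonempty → J.card ≤ n → Fintype.card F ^ 3 ∣ coeffCount F 𝓕 J) :
    projCount F 𝓕 ≡ coeffCount F 𝓕 ∅ + ∑ J ∈ Finset.univ.filter (fun J : Finset E => n < J.card),
      Fintype.card F ^ (Fintype.card E - J.card) [MOD Fintype.card F ^ 3] := by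
  have h1 : ∀ J ∈ Finset.univ.filter (fun J : Finset E => n < J.card), coeffCount F 𝓕 J =
      Fintype.card F ^ (Fintype.card E - J.card) := by
    intro J hJ
    rw [Finset.mem_filter_univ] at hJ
    have h2 : 𝓕.filter (J ⊆ ·) = ∅ := Finset.filter_eq_empty_iff.2 fun S hS hJS => by
      have := Finset.card_le_card hJS
      rw [hn S hS] at this
      omega
    simp [coeffCount, h2]
  have h2 : ∑ J ∈ Finset.univ.filter (fun J : Finset E => ¬ n < J.card), coeffCount F 𝓕 J ≡
      coeffCount F 𝓕 ∅ [MOD Fintype.card F ^ 3] := by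
    have hmem : ∅ ∈ Finset.univ.filter (fun J : Finset E => ¬ n < J.card) := by simp
    rw [← Finset.add_sum_erase _ _ hmem]
    conv_rhs => rw [← add_zero (coeffCount F 𝓕 ∅)]
    refine Nat.ModEq.add_left _ (Nat.modEq_zero_iff_dvd.2 (Finset.dvd_sum fun J hJ => ?_))
    rw [Finset.mem_erase, Finset.mem_filter_univ] at hJ
    exact h J (Finset.nonempty_iff_ne_empty.2 hJ.1) (not_lt.1 hJ.2)
  rw [projCount_eq_sum, ← Finset.sum_filter_add_sum_filter_not _ (fun J : Finset E => n < J.card),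
    Finset.sum_congr rfl h1, add_comm]
  exact h2.add_right _

end Projective

/-! ### Comparison of the two point counts -/

section Comparison

variable {V E : Type*} (G : Graph V E)

/-- An end point of the edge `e`. -/
noncomputable def source (e : E(G)) : V(G) :=
  ⟨(G.exists_isLink_of_mem_edgeSet e.2).choose,
    (G.exists_isLink_of_mem_edgeSet e.2).choose_spec.choose_spec.left_mem⟩

/-- The other end point of the edge `e`. -/
noncomputable def target (e : E(G)) : V(G) :=
  ⟨(G.exists_isLink_of_mem_edgeSet e.2).choose_spec.choose,
    (G.exists_isLink_of_mem_edgeSet e.2).choose_spec.choose_spec.right_mem⟩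

theorem isLink_iff_source_target (e : E(G)) (x y : V(G)) :
    G.IsLink (e : E) x y ↔
      (source G e = x ∧ target G e = y) ∨ (source G e = y ∧ target G e = x) := by
  have h : G.IsLink (e : E) (source G e) (target G e) :=
    (G.exists_isLink_of_mem_edgeSet e.2).choose_spec.choose_spec
  rw [h.isLink_iff]
  simp only [Subtype.ext_iff, eq_comm]

/-- Spanning trees of `G` without edges in `I` are the spanning trees of the multigraph obtained by
deleting `I`. -/
theorem isTree_iff_isSpanningTree [Fintype V(G)] (I : Finset E(G)) (T : Finset {e // e ∉ I}) :
    IsTree (fun e : {e // e ∉ I} => source G e) (fun e => target G e) T ↔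
      IsSpanningTree G (T.map (Function.Embedding.subtype _)) := by
  rw [IsTree, IsSpanningTree, Finset.card_map]
  refine and_congr_left fun _ => ?_
  have hstep : ∀ x y : V(G),
      (∃ e ∈ (T : Set {e // e ∉ I}), (source G e = x ∧ target G e = y) ∨
        (source G e = y ∧ target G e = x)) ↔
      ∃ e ∈ T.map (Function.Embedding.subtype _), G.IsLink (e : E) x y := by
    intro x y
    simp only [isLink_iff_source_target, Finset.mem_map, Function.Embedding.coe_subtype,
      exists_exists_and_eq_and, Finset.mem_coe]
  constructor
  · intro h u hu v hv
    exact Relation.ReflTransGen.lift Subtype.val (fun x y hxy => (hstep x y).1 hxy) _ _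
      (h ⟨u, hu⟩ ⟨v, hv⟩)
  · intro h u v
    have key : ∀ v : V, Relation.ReflTransGen
        (fun x y => ∃ e ∈ T.map (Function.Embedding.subtype _), G.IsLink (e : E) x y) u v →
        ∃ hv : v ∈ V(G), Reach (fun e : {e // e ∉ I} => source G e) (fun e => target G e) T u
          ⟨v, hv⟩ := by
      intro v hr
      induction hr with
      | refl => exact ⟨u.2, Relation.ReflTransGen.refl⟩
      | tail _ hl ih =>
        obtain ⟨hx, ih⟩ := ih
        have hy := hl.choose_spec.2.right_mem
        exact ⟨hy, ih.tail ((hstep ⟨_, hx⟩ ⟨_, hy⟩).2 hl)⟩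
    exact (key v (h u u.2 v v.2)).2

variable [Fintype V(G)] [Fintype E(G)] (F : Type*) [Field F]

open scoped Classical in
theorem pointCount_dualGraphPoly :
    pointCount (dualGraphPoly G) F = coeffCount F (spanningTrees G) ∅ := by
  refine Nat.card_congr ((Equiv.arrowCongr
    (Equiv.subtypeUnivEquiv (p := fun e : E(G) => e ∉ (∅ : Finset E(G))) (by simp)).symm
    (Equiv.refl F)).subtypeEquiv fun a => ?_)
  rw [dualGraphPoly, map_sum, Finset.filter_true_of_mem fun _ _ => Finset.empty_subset _]
  refine Eq.congr (Finset.sum_congr rfl fun T _ => ?_) rfl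
  have h := prod_subtype_filter ∅ T a
  rw [Finset.sdiff_empty] at h
  rw [map_prod]
  simp only [MvPolynomial.aeval_X]
  exact h.symm

open scoped Classical in
theorem pointCount_graphPoly :
    pointCount (graphPoly G) F = coeffCount F ((spanningTrees G).image Compl.compl) ∅ := by
  refine Nat.card_congr ((Equiv.arrowCongr
    (Equiv.subtypeUnivEquiv (p := fun e : E(G) => e ∉ (∅ : Finset E(G))) (by simp)).symm
    (Equiv.refl F)).subtypeEquiv fun a => ?_)
  rw [graphPoly, map_sum, Finset.filter_true_of_mem fun _ _ => Finset.empty_subset _,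
    Finset.sum_image fun x _ y _ h => compl_injective h]
  refine Eq.congr (Finset.sum_congr rfl fun T _ => ?_) rfl
  have h := prod_subtype_filter ∅ Tᶜ a
  rw [Finset.sdiff_empty] at h
  rw [map_prod]
  simp only [MvPolynomial.aeval_X]
  rw [show Finset.univ.filter (fun e => e ∉ T) = Tᶜ by ext; simp]
  exact h.symm

open scoped Classical in
theorem pointCount_dualMinorPoly (J : Finset E(G)) :
    pointCount (dualMinorPoly G ∅ J) F = coeffCount F (spanningTrees G) J := by
  refine Nat.card_congr ((Equiv.arrowCongr
    (Equiv.subtypeEquivRight (p := fun e : E(G) => e ∉ ∅ ∪ J) (q := fun e => e ∉ J) (by simp))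
    (Equiv.refl F)).subtypeEquiv fun a => ?_)
  rw [dualMinorPoly, map_sum]
  have hfilter : (spanningTrees G).filter (fun T => J ⊆ T ∧ Disjoint ∅ T) =
      (spanningTrees G).filter (J ⊆ ·) := Finset.filter_congr fun T _ => by simp
  rw [hfilter]
  refine Eq.congr (Finset.sum_congr rfl fun T _ => ?_) rfl
  rw [map_prod]
  simp only [MvPolynomial.aeval_X]
  refine Finset.prod_equiv (Equiv.subtypeEquivRight (by simp)) (fun e => ?_) fun e _ => ?_
  · simp
  · simp

open scoped Classical in
theorem card_treeSum_eq_coeffCount (I : Finset E(G)) :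
    Nat.card {α : {e // e ∉ I} → F //
      treeSum (fun e : {e // e ∉ I} => source G e) (fun e => target G e) α = 0} =
    coeffCount F ((spanningTrees G).image Compl.compl) I := by
  refine Nat.card_congr (Equiv.subtypeEquivRight fun α => ?_)
  refine Eq.congr ?_ rfl
  rw [treeSum]
  refine Finset.sum_bij (fun T _ => (T.map (Function.Embedding.subtype _))ᶜ) ?_ ?_ ?_ ?_
  · intro T hT
    rw [Finset.mem_filter_univ, isTree_iff_isSpanningTree] at hT
    rw [Finset.mem_filter, Finset.mem_image]
    refine ⟨⟨_, by simpa [spanningTrees] using hT, rfl⟩, fun e he => ?_⟩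
    simp [he]
  · intro T _ T' _ h
    exact Finset.map_injective _ (compl_injective h)
  · intro S hS
    rw [Finset.mem_filter, Finset.mem_image] at hS
    obtain ⟨⟨T, hT, rfl⟩, hI⟩ := hS
    have hTI : (T.subtype fun e => e ∉ I).map (Function.Embedding.subtype _) = T := by
      rw [Finset.subtype_map, Finset.filter_true_of_mem]
      exact fun e he heI => Finset.mem_compl.1 (hI heI) he
    refine ⟨T.subtype fun e => e ∉ I, ?_, by rw [hTI]⟩
    rw [Finset.mem_filter_univ, isTree_iff_isSpanningTree, hTI]
    simpa [spanningTrees] using hT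
  · intro T _
    refine Finset.prod_congr ?_ fun _ _ => rfl
    ext e
    simp [e.2]

/-- The congruence of the two point counts, and the divisibility of one of them by `q²`.  The number
of zeros in the product of projective lines of the multihomogeneous form belonging to the spanning
trees is invariant under the Cremona transformation.  The points at infinity contribute multiples of
`q³` on one side by admissibility, and on the other side by the vanishing theorem for graphs with
fewer edges. -/
theorem pointCount_graphPoly_modEq [Fintype F] (hG : DualityAdmissible G F) :
    Fintype.card F ^ 2 ∣ pointCount (graphPoly G) F ∧
    pointCount (graphPoly G) F ≡ pointCount (dualGraphPoly G) F [MOD Fintype.card F ^ 3] := by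
  classical
  obtain ⟨hlog, hh, hn, hadm⟩ := hG
  unfold LogDivergent at hlog
  unfold loopNumber numEdges numVerticesPred at *
  obtain ⟨n, hW⟩ : ∃ n, Fintype.card V(G) = n + 1 := ⟨Fintype.card V(G) - 1, by omega⟩
  have hE : Fintype.card E(G) = 2 * n := by omega
  have hn3 : 3 ≤ n := by omega
  have hT : ∀ T ∈ spanningTrees G, T.card = n := by
    intro T hT
    have h : IsSpanningTree G T := by simpa [spanningTrees] using hT
    have := h.2
    omega
  have hT' : ∀ S ∈ (spanningTrees G).image Compl.compl, S.card = n := by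
    intro S hS
    obtain ⟨T, hTm, rfl⟩ := Finset.mem_image.1 hS
    rw [Finset.card_compl, hT T hTm]
    omega
  have hcard : ∀ I : Finset E(G), Fintype.card {e // e ∉ I} = 2 * n - I.card := by
    intro I
    rw [Fintype.card_subtype_compl, Fintype.card_coe, hE]
  have h1 := projCount_modEq (F := F) (spanningTrees G) hT
    fun J hJ hJn => by
      rw [← pointCount_dualMinorPoly]
      refine Nat.modEq_zero_iff_dvd.1 (hadm ∅ J (Finset.disjoint_empty_left _) ?_ ?_ ?_)
      · rw [Finset.card_empty]
        exact hJ.card_pos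
      · rw [Finset.card_empty]
        omega
      · omega
  have h2 := projCount_modEq (F := F) _ hT' fun I hI hIn => by
    rw [← card_treeSum_eq_coeffCount]
    have := hI.card_pos
    have := hcard I
    exact cube_dvd_card_treeSum _ _ (by omega) (by omega) (by omega)
  rw [projCount_image_compl] at h2
  rw [← pointCount_dualGraphPoly] at h1
  rw [← pointCount_graphPoly] at h2
  refine ⟨?_, Nat.ModEq.add_right_cancel' _ (h2.symm.trans h1)⟩
  rw [pointCount_graphPoly, ← card_treeSum_eq_coeffCount]
  have := hcard ∅
  rw [Finset.card_empty] at this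
  exact sq_dvd_card_treeSum _ _ (by omega) (by omega) (by omega)

end Comparison

end FeynmanGraph

/-- For a duality admissible graph the parametric and the dual parametric `c₂` invariants are
well defined and coincide; equivalently the point counts of `Ψ_G` and `Φ_G` agree modulo `q³`. -/
theorem mainTheorem1 {V E : Type*} (G : Graph V E) [Fintype V(G)] [Fintype E(G)]
    (F : Type*) [Field F] [Fintype F] (hG : FeynmanGraph.DualityAdmissible G F) :
    (Fintype.card F ^ 2 ∣ FeynmanGraph.pointCount (FeynmanGraph.graphPoly G) F ∧
      Fintype.card F ^ 2 ∣ FeynmanGraph.pointCount (FeynmanGraph.dualGraphPoly G) F) ∧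
    FeynmanGraph.c2 G F = FeynmanGraph.c2dual G F ∧
    FeynmanGraph.pointCount (FeynmanGraph.graphPoly G) F ≡
      FeynmanGraph.pointCount (FeynmanGraph.dualGraphPoly G) F [MOD Fintype.card F ^ 3] := by
  obtain ⟨hsq, hmod⟩ := FeynmanGraph.pointCount_graphPoly_modEq G F hG
  have hsq' : Fintype.card F ^ 2 ∣ FeynmanGraph.pointCount (FeynmanGraph.dualGraphPoly G) F :=
    (hmod.dvd_iff (pow_dvd_pow _ (by norm_num))).1 hsq
  refine ⟨⟨hsq, hsq'⟩, ?_, hmod⟩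
  have hq : 0 < Fintype.card F := Fintype.card_pos
  obtain ⟨a, ha⟩ := hsq
  obtain ⟨b, hb⟩ := hsq'
  rw [FeynmanGraph.c2, FeynmanGraph.c2dual, ZMod.natCast_eq_natCast_iff]
  rw [ha, hb] at hmod ⊢
  rw [Nat.mul_div_cancel_left _ (by positivity), Nat.mul_div_cancel_left _ (by positivity)]
  rw [pow_succ _ 2] at hmod
  exact Nat.ModEq.mul_left_cancel' (by positivity) hmod
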